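/- Let $\Bbbk$ be a field of characteristic zero (not necessarily algebraically closed). For $f \in \Bbbk(x,y)$ let $K\{f\}$ denote the field $\Bbbk(x,y)$ with the unique ($\Bbbk$-bilinear) Poisson bracket such that $\{x,y\}=f$, namely $\{g,h\}=(g_xh_y-g_yh_x)f$. Put $K_{\mathrm{Weyl}}=K\{1\}$, and, for $q\in\Bbbk^\times$ and integers $a,b$, put $K_q=K\{qxy\}$ and $K_{q,a,b}=K\{qx^{1+a}y^{1+b}\}$. An embedding is an injective homomorphism of Poisson $\Bbbk$-algebras, and a Poisson field has the Dixmier property if each of its Poisson endomorphisms is an automorphism. **Proposition 4.10 (Embedding Problem).** Among the Poisson fields $K_{\mathrm{Weyl}}$, $K_q$ ($q\in\Bbbk^\times$) and $K_{1,n,0}$ there are the following embeddings: 1. $K_{\mathrm{Weyl}}$ embeds in $K_{1,n,0}$ for every $n\ge 2$. 2. For $p,q\in\Bbbk^\times$, $K_p$ embeds in $K_q$ if and only if $p\in\mathbb{Z}q$. 3. For $m,n\ge 2$, $K_{1,m,0}$ embeds in $K_{1,n,0}$ if and only if $m\mid n$. There are no other embeddings: 4. $K_{\mathrm{Weyl}}$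 and $K_{1,n,0}$ for $n\ge 2$ do not embed in any $K_q$, $q\in\Bbbk^\times$. 5. $K_{1,n,0}$ for $n\ge 2$ does not embed in $K_{\mathrm{Weyl}}$. 6. No $K_q$, $q\in\Bbbk^\times$, embeds in $K_{\mathrm{Weyl}}$ or in $K_{1,n,0}$ for $n\ge 2$. **Proposition 4.9.** Let $q,r\in\Bbbk^\times$ and let $m,n\ge 2$ be integers. 1. $K_{r,m,0}$ embeds in $K_{q,n,0}$ if and only if $m\mid n$ and there exist $0\ne z\in\mathbb{Z}$ and $\beta\in\Bbbk^\times$ with $\beta^m=nqz/(mr)$. 2. The Poisson endomorphisms of $K_{q,n,0}$ are exactly those $\Bbbk$-algebra endomorphisms $\phi$ of $\Bbbk(x,y)$ such that $\phi(x)=cx$ and $\phi(y)=h(x)y^z$ for some $c\in\Bbbk^\times$, $z\in\mathbb{Z}\setminus\{0\}$ and $h(x)\in\Bbbk(x)^\times$ with $c^n=z$. Consequently, every Poisson endomorphism of $K_{q,n,0}$ has image equal to $\Bbbk(x,y^z)$ for some $0\ne z\in\mathbb{Z}$. 3. $K_{q,n,0}$ does not have the Dixmier property. -/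

import Mathlib

/-!
# Poisson brackets on the rational function field in two variables
-/

/-- A Poisson bracket on the commutative `k`-algebra `A`: a `k`-bilinear alternating map which
satisfies the Jacobi identity and is a derivation in its second (hence in each) argument. -/
structure PoissonBracket (k A : Type*) [CommRing k] [CommRing A] [Algebra k A] where
  /-- the underlying bilinear map -/
  bracket : A →ₗ[k] A →ₗ[k] A
  alternating : ∀ a, bracket a a = 0
  jacobi : ∀ a b c,
    bracket a (bracket b c) + bracket b (bracket c a) + bracket c (bracket a b) = 0
  leibniz : ∀ a b c, bracket a (b * c) = b * bracket a c + c * bracket a b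

section PoissonMaps

variable {k A A' : Type*} [CommRing k] [CommRing A] [Algebra k A] [CommRing A'] [Algebra k A']

/-- A `k`-algebra homomorphism is a homomorphism of Poisson algebras if it preserves brackets. -/
def IsPoissonHom (B : PoissonBracket k A) (B' : PoissonBracket k A') (φ : A →ₐ[k] A') : Prop :=
  ∀ a b, φ (B.bracket a b) = B'.bracket (φ a) (φ b)

/-- The Poisson algebra `(A, B)` embeds in the Poisson algebra `(A', B')`: there is an injective
homomorphism of Poisson `k`-algebras. -/
def PoissonEmbeds (B : PoissonBracket k A) (B' : PoissonBracket k A') : Prop :=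
  ∃ φ : A →ₐ[k] A', Function.Injective φ ∧ IsPoissonHom B B' φ

/-- The Dixmier property: every Poisson endomorphism is an automorphism.  (The inverse of a
bijective Poisson homomorphism is again a Poisson homomorphism.) -/
def HasDixmierProperty (B : PoissonBracket k A) : Prop :=
  ∀ φ : A →ₐ[k] A, IsPoissonHom B B φ → Function.Bijective φ

end PoissonMaps

section FractionDerivation

variable {k R : Type*} [CommRing k] [CommRing R] [IsDomain R] [Algebra k R]

/-- The quotient rule `(n / d)' = (d n' - n d') / d ^ 2`, applied to a chosen representation
of an element of the field of fractions. -/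
noncomputable def fracDerivFun (D : Derivation k R R) (a : FractionRing R) : FractionRing R :=
  (algebraMap R (FractionRing R) (IsLocalization.sec (nonZeroDivisors R) a).2 *
      algebraMap R (FractionRing R) (D (IsLocalization.sec (nonZeroDivisors R) a).1) -
    algebraMap R (FractionRing R) (IsLocalization.sec (nonZeroDivisors R) a).1 *
      algebraMap R (FractionRing R) (D (IsLocalization.sec (nonZeroDivisors R) a).2)) /
    algebraMap R (FractionRing R) (IsLocalization.sec (nonZeroDivisors R) a).2 ^ 2

/-- The value of the quotient rule does not depend on the representation. -/
theorem fracDerivFun_eq (D : Derivation k R R) (a : FractionRing R) (n d : R) (hd : d ≠ 0)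
    (h : a * algebraMap R (FractionRing R) d = algebraMap R (FractionRing R) n) :
    fracDerivFun D a =
      (algebraMap R (FractionRing R) d * algebraMap R (FractionRing R) (D n) -
        algebraMap R (FractionRing R) n * algebraMap R (FractionRing R) (D d)) /
        algebraMap R (FractionRing R) d ^ 2 := by
  have hs := IsLocalization.sec_spec (nonZeroDivisors R) a
  have he : (IsLocalization.sec (nonZeroDivisors R) a).2.1 ≠ 0 :=
    nonZeroDivisors.coe_ne_zero _
  unfold fracDerivFun
  generalize (IsLocalization.sec (nonZeroDivisors R) a).1 = m at *
  generalize (IsLocalization.sec (nonZeroDivisors R) a).2.1 = e at *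
  have inj := IsFractionRing.injective R (FractionRing R)
  have hd' : algebraMap R (FractionRing R) d ≠ 0 := by simpa using hd
  have he' : algebraMap R (FractionRing R) e ≠ 0 := by simpa using he
  have h1 : m * d = n * e := by
    apply inj
    rw [map_mul, map_mul, ← h, ← hs]
    ring
  have h2 := congrArg (algebraMap R (FractionRing R)) (congrArg D h1)
  have h3 := congrArg (algebraMap R (FractionRing R)) h1
  simp only [Derivation.leibniz, smul_eq_mul, map_add, map_mul] at h2 h3
  rw [div_eq_div_iff (pow_ne_zero 2 he') (pow_ne_zero 2 hd')]
  generalize algebraMap R (FractionRing R) d = d' at *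
  generalize algebraMap R (FractionRing R) e = e' at *
  generalize algebraMap R (FractionRing R) m = m' at *
  generalize algebraMap R (FractionRing R) n = n' at *
  generalize algebraMap R (FractionRing R) (D d) = d1 at *
  generalize algebraMap R (FractionRing R) (D e) = e1 at *
  generalize algebraMap R (FractionRing R) (D m) = m1 at *
  generalize algebraMap R (FractionRing R) (D n) = n1 at *
  linear_combination d' * e' * h2 - (d' * e1 + e' * d1) * h3

theorem exists_fraction_rep (a : FractionRing R) :
    ∃ n d : R, d ≠ 0 ∧ algebraMap R (FractionRing R) d ≠ 0 ∧
      a * algebraMap R (FractionRing R) d = algebraMap R (FractionRing R) n := by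
  obtain ⟨n, d, hd, rfl⟩ := IsFractionRing.div_surjective (A := R) a
  have hd0 := nonZeroDivisors.ne_zero hd
  have hd1 : algebraMap R (FractionRing R) d ≠ 0 := by simpa using hd0
  exact ⟨n, d, hd0, hd1, div_mul_cancel₀ _ hd1⟩

/-- The extension of a derivation of an integral domain to its field of fractions. -/
noncomputable def fracDeriv (D : Derivation k R R) :
    Derivation k (FractionRing R) (FractionRing R) :=
  Derivation.mk'
    { toFun := fracDerivFun D
      map_add' := by
        intro a b
        obtain ⟨n, d, hd, hd', h⟩ := exists_fraction_rep a
        obtain ⟨m, e, he, he', h'⟩ := exists_fraction_rep b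
        rw [fracDerivFun_eq D a n d hd h, fracDerivFun_eq D b m e he h',
          fracDerivFun_eq D (a + b) (n * e + m * d) (d * e) (mul_ne_zero hd he)
            (by simp only [map_add, map_mul]; rw [← h, ← h']; ring)]
        simp only [Derivation.leibniz, smul_eq_mul, map_add, map_mul]
        field_simp
        ring
      map_smul' := by
        intro c a
        obtain ⟨n, d, hd, hd', h⟩ := exists_fraction_rep a
        have hc : ∀ r : R, algebraMap R (FractionRing R) (c • r) =
            c • algebraMap R (FractionRing R) r :=
          fun r => map_smul (IsScalarTower.toAlgHom k R (FractionRing R)) c r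
        rw [fracDerivFun_eq D a n d hd h,
          fracDerivFun_eq D (c • a) (c • n) d hd (by rw [hc, ← h, smul_mul_assoc]),
          D.map_smul, hc, hc, RingHom.id_apply, ← smul_div_assoc, smul_sub, mul_smul_comm,
          smul_mul_assoc] }
    (by
      intro a b
      obtain ⟨n, d, hd, hd', h⟩ := exists_fraction_rep a
      obtain ⟨m, e, he, he', h'⟩ := exists_fraction_rep b
      change fracDerivFun D (a * b) = a • fracDerivFun D b + b • fracDerivFun D a
      rw [fracDerivFun_eq D a n d hd h, fracDerivFun_eq D b m e he h',
        fracDerivFun_eq D (a * b) (n * m) (d * e) (mul_ne_zero hd he)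
          (by simp only [map_mul]; rw [← h, ← h']; ring)]
      simp only [Derivation.leibniz, smul_eq_mul, map_add, map_mul, ← h, ← h']
      field_simp
      ring)

theorem fracDeriv_algebraMap (D : Derivation k R R) (r : R) :
    fracDeriv D (algebraMap R (FractionRing R) r) = algebraMap R (FractionRing R) (D r) := by
  have := fracDerivFun_eq D (algebraMap R (FractionRing R) r) r 1 one_ne_zero (by simp)
  rw [map_one, Derivation.map_one_eq_zero, map_zero, mul_zero, one_mul, sub_zero, one_pow,
    div_one] at this
  exact this

/-- Derivations of a field of fractions are determined by their values on the ring. -/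
theorem fracDeriv_ext {D E : Derivation k (FractionRing R) (FractionRing R)}
    (h : ∀ r : R, D (algebraMap R _ r) = E (algebraMap R _ r)) : D = E := by
  ext a
  obtain ⟨n, d, hd, rfl⟩ := IsFractionRing.div_surjective (A := R) a
  rw [Derivation.leibniz_div, Derivation.leibniz_div, h, h]

end FractionDerivation

section PoissonFields

variable (k : Type*) [Field k]

/-- The rational function field `k(x, y)`. -/
abbrev RatField : Type _ := FractionRing (MvPolynomial (Fin 2) k)

variable {k}

/-- The first variable `x` of `k(x, y)`. -/
noncomputable def varX : RatField k := algebraMap (MvPolynomial (Fin 2) k) _ (MvPolynomial.X 0)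

/-- The second variable `y` of `k(x, y)`. -/
noncomputable def varY : RatField k := algebraMap (MvPolynomial (Fin 2) k) _ (MvPolynomial.X 1)

/-- The partial derivatives `∂/∂x` (for `i = 0`) and `∂/∂y` (for `i = 1`) on `k(x, y)`. -/
noncomputable def partialD (i : Fin 2) : Derivation k (RatField k) (RatField k) :=
  fracDeriv (MvPolynomial.pderiv i)

/-- Derivations of `k(x, y)` are determined by their values at `x` and `y`. -/
theorem derivation_ext {D E : Derivation k (RatField k) (RatField k)}
    (hx : D varX = E varX) (hy : D varY = E varY) : D = E := by
  apply fracDeriv_ext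
  intro r
  have : D.compAlgebraMap (MvPolynomial (Fin 2) k) = E.compAlgebraMap (MvPolynomial (Fin 2) k) := by
    apply MvPolynomial.derivation_ext
    intro i
    fin_cases i
    · exact hx
    · exact hy
  exact congrArg (fun F => F r) this

theorem partialD_zero_varX : partialD 0 (varX : RatField k) = 1 := by
  simp [partialD, varX, fracDeriv_algebraMap, MvPolynomial.pderiv_X]

theorem partialD_zero_varY : partialD 0 (varY : RatField k) = 0 := by
  simp [partialD, varY, fracDeriv_algebraMap, MvPolynomial.pderiv_X]

theorem partialD_one_varX : partialD 1 (varX : RatField k) = 0 := by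
  simp [partialD, varX, fracDeriv_algebraMap, MvPolynomial.pderiv_X]

theorem partialD_one_varY : partialD 1 (varY : RatField k) = 1 := by
  simp [partialD, varY, fracDeriv_algebraMap, MvPolynomial.pderiv_X]

theorem partialD_comm (a : RatField k) :
    partialD 0 (partialD 1 a) = partialD 1 (partialD 0 a) := by
  have h : ⁅(partialD 0 : Derivation k (RatField k) (RatField k)),
      (partialD 1 : Derivation k (RatField k) (RatField k))⁆ = 0 := by
    apply derivation_ext <;>
      simp [Derivation.commutator_apply, partialD_zero_varX, partialD_zero_varY,
        partialD_one_varX, partialD_one_varY]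
  have := congrArg (fun F => F a) h
  simpa [Derivation.commutator_apply, sub_eq_zero] using this

/-- The Poisson field `K{f}`: the field `k(x, y)` with the Poisson bracket
`{g, h} = (g_x h_y - g_y h_x) f`. -/
noncomputable def flagBracket (f : RatField k) : PoissonBracket k (RatField k) where
  bracket := LinearMap.mk₂ k
    (fun g h => (partialD 0 g * partialD 1 h - partialD 1 g * partialD 0 h) * f)
    (by intro a b c; simp only [map_add]; ring)
    (by intro a b c; simp only [Derivation.map_smul]; simp only [Algebra.smul_def]; ring)
    (by intro a b c; simp only [map_add]; ring)
    (by intro a b c; simp only [Derivation.map_smul]; simp only [Algebra.smul_def]; ring)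
  alternating := by intro a; simp only [LinearMap.mk₂_apply]; ring
  jacobi := by
    intro a b c
    simp only [LinearMap.mk₂_apply, Derivation.leibniz, map_sub, smul_eq_mul, partialD_comm]
    ring
  leibniz := by
    intro a b c
    simp only [LinearMap.mk₂_apply, Derivation.leibniz, smul_eq_mul]
    ring

theorem flagBracket_apply (f g h : RatField k) :
    (flagBracket f).bracket g h =
      (partialD 0 g * partialD 1 h - partialD 1 g * partialD 0 h) * f := rfl

/-- In `K{f}` one has `{x, y} = f`. -/
theorem flagBracket_varX_varY (f : RatField k) : (flagBracket f).bracket varX varY = f := by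
  simp [flagBracket_apply, partialD_zero_varX, partialD_zero_varY, partialD_one_varX,
    partialD_one_varY]

/-- `K{f}` carries the only Poisson bracket on `k(x, y)` for which `{x, y} = f`. -/
theorem bracket_eq_flagBracket (B : PoissonBracket k (RatField k)) (g h : RatField k) :
    B.bracket g h = (flagBracket (B.bracket varX varY)).bracket g h := by
  have skew : ∀ (C : PoissonBracket k (RatField k)) (a b : RatField k),
      C.bracket a b = -C.bracket b a := by
    intro C a b
    have := C.alternating (a + b)
    simp only [map_add, LinearMap.add_apply, C.alternating, zero_add, add_zero] at this
    linear_combination this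
  let ad : PoissonBracket k (RatField k) → RatField k → Derivation k (RatField k) (RatField k) :=
    fun C a => Derivation.mk' (C.bracket a) (fun b c => C.leibniz a b c)
  have h1 : ∀ (C C' : PoissonBracket k (RatField k)) (a : RatField k),
      C.bracket a varX = C'.bracket a varX → C.bracket a varY = C'.bracket a varY →
      ∀ b, C.bracket a b = C'.bracket a b := fun C C' a hx hy b =>
    congrArg (fun F => F b) (derivation_ext (D := ad C a) (E := ad C' a) hx hy)
  have hxy := flagBracket_varX_varY (B.bracket varX varY)
  have hx : ∀ b, B.bracket varX b = (flagBracket (B.bracket varX varY)).bracket varX b :=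
    h1 _ _ _ (by rw [B.alternating, PoissonBracket.alternating]) hxy.symm
  have hy : ∀ b, B.bracket varY b = (flagBracket (B.bracket varX varY)).bracket varY b :=
    h1 _ _ _ (by rw [skew, skew (flagBracket _), hxy])
      (by rw [B.alternating, PoissonBracket.alternating])
  exact h1 _ _ _ (by rw [skew, hx, ← skew]) (by rw [skew, hy, ← skew]) h

/-- The Weyl Poisson field, `{x, y} = 1`. -/
noncomputable def weylField : PoissonBracket k (RatField k) :=
  flagBracket 1

/-- The `q`-skew Poisson field `K_q`, `{x, y} = q x y`. -/
noncomputable def skewField (q : k) : PoissonBracket k (RatField k) :=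
  flagBracket (q • (varX * varY))

/-- The Poisson field `K_{q,a,b}`, `{x, y} = q x ^ (1 + a) y ^ (1 + b)`. -/
noncomputable def monomialField (q : k) (a b : ℤ) : PoissonBracket k (RatField k) :=
  flagBracket (q • (varX ^ (1 + a) * varY ^ (1 + b)))

end PoissonFields

/-! ## Polynomials: partial derivatives and degrees -/

section PolynomialDegree

variable {k : Type*} [Field k]

/-! By the chain rule, a homomorphism from `K{f}` to `K{g}` is Poisson exactly when `{φ x, φ y} = φ
f`. Conversely, any `u`, `v` with nonzero bracket are images of `x`, `y`, by the Jacobian criterion.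
So each embedding amounts to one equation. With the Euler operators `θ₀ = x ∂/∂x`, `θ₁ = y ∂/∂y` and
`logBracket a b = θ₀a θ₁b - θ₁a θ₀b`, the bracket of `K_q` is `q • logBracket`, and that of
`K_{q,n,0}` is `q x^n • logBracket`. The obstructions come from two sources.

Expansion at infinitesimal `x`, `y`: in Hahn series over lexicographic `ℤ × ℤ` the Euler operators
are diagonal. Leading terms show that `logBracket a b = c a b` forces `c` to be an integer
(`exists_int_of_logBracket_eq`). Constant terms show that `logBracket` is never a nonzero constant
(`logBracket_ne_algebraMap`).

Poles: put `f = logBracket a b / (a b)`. It has at most a simple pole along each prime of `k[x, y]`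
and none along `x`, and its total degree is at most zero. Having no pole along `x` excludes `K_q`
from `K_{1,n,0}`. An embedding of `K_{r,m,0}` in `K_{q,n,0}` gives `f x^n = c a^m` for `a = φ x`.
For `m ≥ 2`, a pole of `a` away from `x` would give `f` a multiple pole, so `f` is a polynomial of
degree zero, and `a = e x^i` with `n = m i` (`eq_smul_pow_of_logBracket_eq`). Then `φ y` is an
eigenvector of `θ₁`, its eigenvalue is an integer `z`, and `φ y / y^z` is killed by `∂/∂y`, so lies
in `k(x)`.

The remaining exclusions follow by composing with embeddings of the Weyl field. -/

open MvPolynomial in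
theorem totalDegree_pderiv_lt_of_ne_zero {σ : Type*} (i : σ) {p : MvPolynomial σ k}
    (h : pderiv i p ≠ 0) : (pderiv i p).totalDegree < p.totalDegree := by
  obtain ⟨m, hm, hd⟩ := (pderiv i p).support.exists_mem_eq_sup
    (by simpa [Finset.nonempty_iff_ne_empty] using h) (fun s => s.sum fun _ e => e)
  rw [totalDegree, hd]
  have hc : m + Finsupp.single i 1 ∈ p.support := by
    rw [mem_support_iff, coeff_pderiv] at hm
    exact mem_support_iff.2 (left_ne_zero_of_mul hm)
  have := le_totalDegree hc
  rw [Finsupp.sum_add_index' (by simp) (by simp), Finsupp.sum_single_index rfl] at this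
  omega

open MvPolynomial in
theorem coeff_eq_zero_of_pderiv_eq_zero {σ : Type*} [CharZero k] {i : σ} {p : MvPolynomial σ k}
    (h : pderiv i p = 0) {m : σ →₀ ℕ} (hm : m i ≠ 0) : coeff m p = 0 := by
  have h1 := coeff_pderiv (i := i) p (m - Finsupp.single i 1)
  rw [h, coeff_zero, tsub_add_cancel_of_le (by simpa [Nat.one_le_iff_ne_zero] using hm)] at h1
  exact (mul_eq_zero.1 h1.symm).resolve_right (Nat.cast_add_one_ne_zero _)

open MvPolynomial in
theorem eq_C_of_forall_pderiv_eq_zero {σ : Type*} [CharZero k] {p : MvPolynomial σ k}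
    (h : ∀ i, pderiv i p = 0) : p = C (coeff 0 p) := by
  classical
  ext m
  rw [coeff_C]
  split_ifs with hm
  · rw [hm]
  · obtain ⟨i, hi⟩ := Finsupp.ne_iff.1 (Ne.symm hm)
    exact coeff_eq_zero_of_pderiv_eq_zero (h i) hi

open MvPolynomial in
/-- The Euler operator `X i * ∂/∂X i` on polynomials. -/
noncomputable def polyEuler {σ : Type*} (i : σ) :
    Derivation k (MvPolynomial σ k) (MvPolynomial σ k) :=
  (X i : MvPolynomial σ k) • pderiv i

open MvPolynomial in
theorem polyEuler_apply {σ : Type*} (i : σ) (p : MvPolynomial σ k) :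
    polyEuler i p = X i * pderiv i p := rfl

open MvPolynomial in
theorem totalDegree_polyEuler_le {σ : Type*} (i : σ) (p : MvPolynomial σ k) :
    (polyEuler i p).totalDegree ≤ p.totalDegree := by
  rw [polyEuler_apply]
  by_cases h : pderiv i p = 0
  · simp [h]
  · have := totalDegree_pderiv_lt_of_ne_zero i h
    rw [totalDegree_mul_of_isDomain (X_ne_zero i) h, totalDegree_X]
    omega

end PolynomialDegree

/-! ## Homomorphisms from `k(x, y)` to other fields -/

section FieldHoms

variable {k : Type*} [Field k] {L : Type*} [Field L] [Algebra k L]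

open MvPolynomial

theorem algebraMap_injective_ratField :
    Function.Injective (algebraMap (MvPolynomial (Fin 2) k) (RatField k)) :=
  IsFractionRing.injective _ _

theorem algebraMap_C_ratField (c : k) :
    algebraMap (MvPolynomial (Fin 2) k) (RatField k) (C c) = algebraMap k (RatField k) c :=
  (IsScalarTower.algebraMap_apply k (MvPolynomial (Fin 2) k) (RatField k) c).symm

theorem partialD_algebraMap (i : Fin 2) (p : MvPolynomial (Fin 2) k) :
    partialD i (algebraMap _ (RatField k) p) = algebraMap _ (RatField k) (pderiv i p) :=
  fracDeriv_algebraMap _ _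

theorem derivation_aeval (D : Derivation k L L) (f : Fin 2 → L) (p : MvPolynomial (Fin 2) k) :
    D (aeval f p) = aeval f (pderiv 0 p) * D (f 0) + aeval f (pderiv 1 p) * D (f 1) := by
  induction p using MvPolynomial.induction_on with
  | C a => simp
  | add p q hp hq => simp only [map_add, hp, hq]; ring
  | mul_X p i hp =>
    simp only [map_mul, aeval_X, Derivation.leibniz, smul_eq_mul, map_add, hp]
    fin_cases i <;> simp [pderiv_X] <;> ring

theorem algHom_algebraMap (φ : RatField k →ₐ[k] L) (p : MvPolynomial (Fin 2) k) :
    φ (algebraMap _ (RatField k) p) = aeval ![φ varX, φ varY] p := by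
  have : φ.comp (IsScalarTower.toAlgHom k (MvPolynomial (Fin 2) k) (RatField k)) =
      aeval ![φ varX, φ varY] := by
    ext i
    fin_cases i <;> simp [varX, varY]
  exact congrArg (fun F => F p) this

/-- The chain rule. -/
theorem derivation_algHom (D : Derivation k L L) (φ : RatField k →ₐ[k] L) (a : RatField k) :
    D (φ a) = φ (partialD 0 a) * D (φ varX) + φ (partialD 1 a) * D (φ varY) := by
  obtain ⟨n, d, hd, rfl⟩ := IsFractionRing.div_surjective (A := MvPolynomial (Fin 2) k) a
  have hd1 : φ (algebraMap _ (RatField k) d) ≠ 0 := by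
    rw [Ne, map_eq_zero, map_eq_zero_iff _ algebraMap_injective_ratField]
    exact nonZeroDivisors.ne_zero hd
  have key : ∀ p : MvPolynomial (Fin 2) k, D (φ (algebraMap _ (RatField k) p)) =
      φ (partialD 0 (algebraMap _ (RatField k) p)) * D (φ varX) +
        φ (partialD 1 (algebraMap _ (RatField k) p)) * D (φ varY) := by
    intro p
    rw [algHom_algebraMap, derivation_aeval, partialD_algebraMap, partialD_algebraMap,
      algHom_algebraMap, algHom_algebraMap]
    simp
  simp only [Derivation.leibniz_div, map_div₀, key, map_pow, smul_eq_mul, map_sub, map_mul,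
    map_inv₀]
  ring

/-- The Jacobian criterion for algebraic independence in characteristic zero. -/
theorem aeval_injective_of_jacobian [CharZero k] (D E : Derivation k L L) (f : Fin 2 → L)
    (h : D (f 0) * E (f 1) - E (f 0) * D (f 1) ≠ 0) :
    Function.Injective (aeval f : MvPolynomial (Fin 2) k →ₐ[k] L) := by
  rw [injective_iff_map_eq_zero]
  intro p
  induction hn : p.totalDegree using Nat.strong_induction_on generalizing p with
  | _ n ih =>
    intro hp
    have hD := derivation_aeval D f p
    have hE := derivation_aeval E f p
    rw [hp, map_zero] at hD hE
    -- The two chain-rule identities are a homogeneous linear system with determinant the Jacobian;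
    -- Cramer's rule kills both unknowns.
    have h0 : aeval f (pderiv 0 p) = 0 := by
      refine (mul_eq_zero.1 ?_).resolve_right h
      linear_combination E (f 1) * (-hD) + D (f 1) * hE
    have h1 : aeval f (pderiv 1 p) = 0 := by
      refine (mul_eq_zero.1 ?_).resolve_right h
      linear_combination E (f 0) * hD - D (f 0) * hE
    -- A nonzero partial derivative would be an algebraic relation of smaller degree.
    have key : ∀ i, pderiv i p = 0 := by
      intro i
      by_contra hi
      exact hi (ih _ (hn ▸ totalDegree_pderiv_lt_of_ne_zero i hi) _ rfl
        (by fin_cases i; exacts [h0, h1]))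
    have hc := eq_C_of_forall_pderiv_eq_zero key
    rw [hc, aeval_C, map_eq_zero] at hp
    rw [hc, hp, map_zero]

/-- The source of all homomorphisms used below: those between the Poisson fields and, with another
target `L`, the Laurent expansion. -/
theorem exists_algHom_of_jacobian [CharZero k] (D E : Derivation k L L) (u v : L)
    (h : D u * E v - E u * D v ≠ 0) : ∃ φ : RatField k →ₐ[k] L, φ varX = u ∧ φ varY = v := by
  have hinj := aeval_injective_of_jacobian D E ![u, v] (by simpa using h)
  refine ⟨IsFractionRing.liftAlgHom (g := aeval ![u, v]) hinj, ?_, ?_⟩ <;>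
    simp [varX, varY, IsFractionRing.liftAlgHom_apply, IsFractionRing.lift_algebraMap]

end FieldHoms

/-! ## Poisson embeddings in terms of generators -/

section Embeddings

variable {k : Type*} [Field k]

theorem varX_ne_zero : (varX : RatField k) ≠ 0 := by
  simp [varX]

theorem varY_ne_zero : (varY : RatField k) ≠ 0 := by
  simp [varY]

/-- Multiplicativity of Jacobian determinants under composition. -/
theorem flagBracket_algHom (f : RatField k) (φ : RatField k →ₐ[k] RatField k) (a b : RatField k) :
    (flagBracket f).bracket (φ a) (φ b) =
      φ (partialD 0 a * partialD 1 b - partialD 1 a * partialD 0 b) *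
        (flagBracket f).bracket (φ varX) (φ varY) := by
  simp only [flagBracket_apply, derivation_algHom (partialD 0) φ a,
    derivation_algHom (partialD 0) φ b, derivation_algHom (partialD 1) φ a,
    derivation_algHom (partialD 1) φ b, map_sub, map_mul]
  ring

theorem isPoissonHom_flagBracket_iff (f g : RatField k) (φ : RatField k →ₐ[k] RatField k) :
    IsPoissonHom (flagBracket f) (flagBracket g) φ ↔
      (flagBracket g).bracket (φ varX) (φ varY) = φ f := by
  constructor
  · intro h
    rw [← h, flagBracket_varX_varY]
  · intro h a b
    rw [flagBracket_algHom, h, flagBracket_apply, map_mul]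

theorem poissonEmbeds_flagBracket_iff (f g : RatField k) :
    PoissonEmbeds (flagBracket f) (flagBracket g) ↔
      ∃ φ : RatField k →ₐ[k] RatField k, (flagBracket g).bracket (φ varX) (φ varY) = φ f :=
  exists_congr fun φ => by
    rw [isPoissonHom_flagBracket_iff]
    exact and_iff_right φ.injective

theorem PoissonEmbeds.trans {A A' A'' : Type*} [CommRing A] [Algebra k A] [CommRing A']
    [Algebra k A'] [CommRing A''] [Algebra k A''] {B : PoissonBracket k A}
    {B' : PoissonBracket k A'} {B'' : PoissonBracket k A''} (h : PoissonEmbeds B B')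
    (h' : PoissonEmbeds B' B'') : PoissonEmbeds B B'' := by
  obtain ⟨φ, hφ, h⟩ := h
  obtain ⟨ψ, hψ, h'⟩ := h'
  refine ⟨ψ.comp φ, hψ.comp hφ, fun a b => ?_⟩
  simp [h a b, h' (φ a) (φ b)]

theorem exists_algHom_of_bracket_ne_zero [CharZero k] {g u v : RatField k}
    (h : (flagBracket g).bracket u v ≠ 0) :
    ∃ φ : RatField k →ₐ[k] RatField k, φ varX = u ∧ φ varY = v := by
  refine exists_algHom_of_jacobian (partialD 0) (partialD 1) u v fun h0 => h ?_
  rw [flagBracket_apply, h0, zero_mul]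

end Embeddings

/-! ## Euler operators and the kernel of `∂/∂y` -/

section Euler

variable {k : Type*} [Field k]

open MvPolynomial

/-- The Euler operators `x ∂/∂x` and `y ∂/∂y` on `k(x, y)`. -/
noncomputable def euler (i : Fin 2) : Derivation k (RatField k) (RatField k) :=
  (algebraMap (MvPolynomial (Fin 2) k) (RatField k) (X i)) • partialD i

theorem euler_zero_apply (a : RatField k) : euler 0 a = varX * partialD 0 a := rfl

theorem euler_one_apply (a : RatField k) : euler 1 a = varY * partialD 1 a := rfl

theorem euler_algebraMap (i : Fin 2) (p : MvPolynomial (Fin 2) k) :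
    euler i (algebraMap _ (RatField k) p) = algebraMap _ (RatField k) (polyEuler i p) := by
  rw [polyEuler_apply, map_mul, ← partialD_algebraMap]
  rfl

/-- The Poisson bracket with `{x, y} = x y`. -/
noncomputable def logBracket (a b : RatField k) : RatField k :=
  euler 0 a * euler 1 b - euler 1 a * euler 0 b

theorem flagBracket_eq_logBracket (f a b : RatField k) :
    (flagBracket f).bracket a b = logBracket a b * (f / (varX * varY)) := by
  have := varX_ne_zero (k := k)
  have := varY_ne_zero (k := k)
  rw [flagBracket_apply, logBracket, euler_zero_apply, euler_zero_apply, euler_one_apply,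
    euler_one_apply]
  field_simp

/-- In lowest terms `h = n / d`, the quotient rule makes `d` divide its own `y`-derivative, which
has smaller degree unless zero. Hence `d`, and then `n`, is free of `y`. -/
theorem mem_adjoin_varX_of_partialD_eq_zero [CharZero k] {h : RatField k}
    (hh : partialD 1 h = 0) : h ∈ IntermediateField.adjoin k {(varX : RatField k)} := by
  have poly : ∀ p : MvPolynomial (Fin 2) k, pderiv 1 p = 0 →
      algebraMap _ (RatField k) p ∈ IntermediateField.adjoin k {(varX : RatField k)} := by
    intro p hp
    rw [p.as_sum, map_sum]
    refine sum_mem fun m hm => ?_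
    have hm1 : m 1 = 0 := by
      by_contra hne
      exact (mem_support_iff.1 hm) (coeff_eq_zero_of_pderiv_eq_zero hp hne)
    rw [monomial_eq, Finsupp.prod_fintype _ _ (by simp), Fin.prod_univ_two, hm1, pow_zero, mul_one,
      map_mul, map_pow]
    refine mul_mem ?_ (pow_mem (IntermediateField.mem_adjoin_simple_self k _) _)
    rw [algebraMap_C_ratField]
    exact IntermediateField.algebraMap_mem _ _
  obtain ⟨n, d, hd0, hd1, hnd⟩ :
      ∃ n d : MvPolynomial (Fin 2) k, d ≠ 0 ∧ IsRelPrime n d ∧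
        h = algebraMap _ (RatField k) n / algebraMap _ (RatField k) d :=
    ⟨_, _, nonZeroDivisors.ne_zero (IsFractionRing.den (MvPolynomial (Fin 2) k) h).2,
      IsFractionRing.num_den_reduced _ h, (IsFractionRing.mk'_num_den' _ h).symm⟩
  have hd' : algebraMap _ (RatField k) d ≠ 0 := by simpa using hd0
  have hrel : d * pderiv 1 n = n * pderiv 1 d := by
    apply algebraMap_injective_ratField
    have h1 : algebraMap _ (RatField k) n = h * algebraMap _ (RatField k) d := by
      rw [hnd]; field_simp
    have h2 := congrArg (partialD 1) h1
    rw [Derivation.leibniz, hh, partialD_algebraMap, partialD_algebraMap, smul_zero, add_zero,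
      smul_eq_mul] at h2
    rw [map_mul, map_mul, h2, h1]
    ring
  have hd2 : pderiv 1 d = 0 := by
    by_contra hne
    have hdvd : d ∣ pderiv 1 d := hd1.symm.dvd_of_dvd_mul_left (Dvd.intro _ hrel)
    obtain ⟨e, he⟩ := hdvd
    have hlt := totalDegree_pderiv_lt_of_ne_zero 1 hne
    rw [he, totalDegree_mul_of_isDomain hd0 (by rintro rfl; simp [he] at hne)] at hlt
    omega
  rw [hd2, mul_zero, mul_eq_zero, or_iff_right hd0] at hrel
  rw [hnd]
  exact div_mem (poly n hrel) (poly d hd2)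

theorem partialD_eq_zero_of_mem_adjoin_varX {h : RatField k}
    (hh : h ∈ IntermediateField.adjoin k {(varX : RatField k)}) : partialD 1 h = 0 := by
  induction hh using IntermediateField.adjoin_induction with
  | mem a ha => rw [Set.mem_singleton_iff.1 ha, partialD_one_varX]
  | algebraMap c => exact Derivation.map_algebraMap _ _
  | add a b _ _ ha hb => rw [map_add, ha, hb, add_zero]
  | mul a b _ _ ha hb => rw [Derivation.leibniz, ha, hb, smul_zero, smul_zero, add_zero]
  | inv a _ ha => rw [Derivation.leibniz_inv, ha, smul_zero]

theorem adjoin_varX_varY :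
    IntermediateField.adjoin k {(varX : RatField k), varY} = ⊤ := by
  rw [eq_top_iff]
  rintro a -
  have poly : ∀ p : MvPolynomial (Fin 2) k,
      algebraMap _ (RatField k) p ∈ IntermediateField.adjoin k {(varX : RatField k), varY} := by
    intro p
    induction p using MvPolynomial.induction_on with
    | C c =>
      rw [algebraMap_C_ratField]
      exact IntermediateField.algebraMap_mem _ _
    | add p q hp hq => rw [map_add]; exact add_mem hp hq
    | mul_X p i hp =>
      rw [map_mul]
      refine mul_mem hp (IntermediateField.subset_adjoin k _ ?_)
      fin_cases i
      exacts [Set.mem_insert _ _, Set.mem_insert_of_mem _ (Set.mem_singleton _)]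
  obtain ⟨n, d, hd, rfl⟩ := IsFractionRing.div_surjective (A := MvPolynomial (Fin 2) k) a
  exact div_mem (poly n) (poly d)

theorem fieldRange_eq_adjoin {L : Type*} [Field L] [Algebra k L] (φ : RatField k →ₐ[k] L) :
    φ.fieldRange = IntermediateField.adjoin k {φ varX, φ varY} := by
  rw [AlgHom.fieldRange_eq_map, ← adjoin_varX_varY, IntermediateField.adjoin_map, Set.image_pair]

end Euler

/-! ## Euler operators on Hahn series -/

section Hahn

variable {k : Type*} [Field k]

section General

variable {Γ : Type*} [AddCommGroup Γ] [LinearOrder Γ]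

/-- The linear map of Hahn series which multiplies the coefficient at `γ` by `l γ`. -/
def hahnEulerLinear (l : Γ →+ k) : HahnSeries Γ k →ₗ[k] HahnSeries Γ k where
  toFun a :=
    { coeff := fun γ => l γ * a.coeff γ
      isPWO_support' := a.isPWO_support.mono fun _ h => right_ne_zero_of_mul h }
  map_add' a b := by ext γ; simp [mul_add]
  map_smul' c a := by ext γ; simp [mul_left_comm]

theorem coeff_hahnEulerLinear (l : Γ →+ k) (a : HahnSeries Γ k) (γ : Γ) :
    (hahnEulerLinear l a).coeff γ = l γ * a.coeff γ := rfl

theorem support_hahnEulerLinear (l : Γ →+ k) (a : HahnSeries Γ k) :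
    (hahnEulerLinear l a).support ⊆ a.support :=
  fun _ h => right_ne_zero_of_mul h

variable [IsOrderedAddMonoid Γ]

/-- Padding with zero terms lets products with different supports be compared over one common index
set. -/
theorem coeff_mul_of_support_subset {a b : HahnSeries Γ k} {s t : Set Γ} (hs : s.IsPWO)
    (ht : t.IsPWO) (has : a.support ⊆ s) (hbt : b.support ⊆ t) (γ : Γ) :
    (a * b).coeff γ = ∑ ij ∈ Finset.antidiagonal hs ht γ, a.coeff ij.1 * b.coeff ij.2 := by
  rw [HahnSeries.coeff_mul]
  refine Finset.sum_subset (fun ij h => ?_) (fun ij h h' => ?_)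
  · rw [Finset.mem_antidiagonal] at h ⊢
    exact ⟨has h.1, hbt h.2.1, h.2.2⟩
  · rw [Finset.mem_antidiagonal] at h h'
    by_contra hne
    exact h' ⟨left_ne_zero_of_mul hne, right_ne_zero_of_mul hne, h.2.2⟩

/-- The derivation of the field of Hahn series which multiplies the coefficient at `γ` by `l γ`,
for an additive map `l`. -/
noncomputable def hahnEuler (l : Γ →+ k) : Derivation k (HahnSeries Γ k) (HahnSeries Γ k) :=
  Derivation.mk' (hahnEulerLinear l) (by
    intro a b
    ext γ
    rw [smul_eq_mul, smul_eq_mul, mul_comm b, HahnSeries.coeff_add, coeff_hahnEulerLinear,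
      HahnSeries.coeff_mul, coeff_mul_of_support_subset a.isPWO_support b.isPWO_support
        subset_rfl (support_hahnEulerLinear l b), coeff_mul_of_support_subset a.isPWO_support
        b.isPWO_support (support_hahnEulerLinear l a) subset_rfl, Finset.mul_sum,
      ← Finset.sum_add_distrib]
    refine Finset.sum_congr rfl fun ij h => ?_
    rw [← (Finset.mem_antidiagonal.1 h).2.2, map_add, coeff_hahnEulerLinear,
      coeff_hahnEulerLinear]
    ring)

theorem coeff_hahnEuler (l : Γ →+ k) (a : HahnSeries Γ k) (γ : Γ) :
    (hahnEuler l a).coeff γ = l γ * a.coeff γ := rfl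

/-- Lower bounds `α`, `β` replace the orders because an Euler operator may kill a leading term. -/
theorem coeff_mul_add_of_forall_lt {a b : HahnSeries Γ k} {α β : Γ}
    (ha : ∀ γ < α, a.coeff γ = 0) (hb : ∀ γ < β, b.coeff γ = 0) :
    (a * b).coeff (α + β) = a.coeff α * b.coeff β := by
  rw [HahnSeries.coeff_mul, Finset.sum_eq_single (α, β)]
  · rintro ⟨i, j⟩ hij hne
    rw [Finset.mem_antidiagonal] at hij
    obtain ⟨hi, hj, hij⟩ := hij
    have h1 : α ≤ i := not_lt.1 fun h => hi (ha i h)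
    have h2 : β ≤ j := not_lt.1 fun h => hj (hb j h)
    have h3 := (add_eq_add_iff_eq_and_eq h1 h2).1 hij.symm
    exact absurd (Prod.ext h3.1.symm h3.2.symm) hne
  · intro h
    rw [Finset.mem_antidiagonal] at h
    by_contra hne
    exact h ⟨left_ne_zero_of_mul hne, right_ne_zero_of_mul hne, rfl⟩

/-- The constant term of a log-canonical Poisson bracket vanishes. -/
theorem coeff_zero_hahnEuler_bracket (l l' : Γ →+ k) (a b : HahnSeries Γ k) :
    (hahnEuler l a * hahnEuler l' b - hahnEuler l' a * hahnEuler l b).coeff 0 = 0 := by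
  -- Exponents contributing to the constant term are opposite, so `l'` at the second is minus `l'`
  -- at the first; the sum becomes symmetric in `l`, `l'`.
  have key : ∀ l l' : Γ →+ k, (hahnEuler l a * hahnEuler l' b).coeff 0 =
      ∑ ij ∈ Finset.antidiagonal a.isPWO_support b.isPWO_support 0,
        -(l ij.1 * l' ij.1 * a.coeff ij.1 * b.coeff ij.2) := by
    intro l l'
    rw [coeff_mul_of_support_subset (a := hahnEuler l a) (b := hahnEuler l' b)
      a.isPWO_support b.isPWO_support
      (support_hahnEulerLinear l a) (support_hahnEulerLinear l' b)]
    refine Finset.sum_congr rfl fun ij h => ?_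
    rw [coeff_hahnEuler, coeff_hahnEuler,
      eq_neg_of_add_eq_zero_right (Finset.mem_antidiagonal.1 h).2.2, map_neg]
    ring
  rw [HahnSeries.coeff_sub, key, key, sub_eq_zero]
  exact Finset.sum_congr rfl fun ij _ => by ring

/-- The leading coefficient of a log-canonical Poisson bracket. -/
theorem coeff_hahnEuler_bracket (l l' : Γ →+ k) (a b : HahnSeries Γ k) :
    (hahnEuler l a * hahnEuler l' b - hahnEuler l' a * hahnEuler l b).coeff (a.order + b.order) =
      (l a.order * l' b.order - l' a.order * l b.order) * (a * b).coeff (a.order + b.order) := by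
  have van : ∀ (c : HahnSeries Γ k), ∀ γ < c.order, c.coeff γ = 0 := fun c γ h =>
    HahnSeries.coeff_eq_zero_of_lt_order h
  have van' : ∀ (l : Γ →+ k) (c : HahnSeries Γ k), ∀ γ < c.order,
      (hahnEuler l c).coeff γ = 0 := fun l c γ h => by rw [coeff_hahnEuler, van c γ h, mul_zero]
  rw [HahnSeries.coeff_sub, coeff_mul_add_of_forall_lt (van' _ _) (van' _ _),
    coeff_mul_add_of_forall_lt (van' _ _) (van' _ _),
    coeff_mul_add_of_forall_lt (van _) (van _)]
  simp only [coeff_hahnEuler]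
  ring

end General

/-- The exponent of `x` in a monomial. -/
def lexFst : ℤ ×ₗ ℤ →+ k where
  toFun γ := ((ofLex γ).1 : k)
  map_zero' := by simp
  map_add' := by simp

/-- The exponent of `y` in a monomial. -/
def lexSnd : ℤ ×ₗ ℤ →+ k where
  toFun γ := ((ofLex γ).2 : k)
  map_zero' := by simp
  map_add' := by simp

/-- Iterated Laurent expansion, compatible with the Euler operators. -/
theorem exists_algHom_hahnSeries [CharZero k] :
    ∃ Φ : RatField k →ₐ[k] HahnSeries (ℤ ×ₗ ℤ) k, ∀ a,
      Φ (euler 0 a) = hahnEuler lexFst (Φ a) ∧ Φ (euler 1 a) = hahnEuler lexSnd (Φ a) := by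
  have hs : ∀ (l : ℤ ×ₗ ℤ →+ k) (γ : ℤ ×ₗ ℤ), hahnEuler l (HahnSeries.single γ (1 : k)) =
      HahnSeries.single γ (l γ) := by
    intro l γ
    ext δ
    rw [coeff_hahnEuler, HahnSeries.coeff_single, HahnSeries.coeff_single]
    split_ifs with h
    · rw [h, mul_one]
    · rw [mul_zero]
  have h10 : (lexFst : ℤ ×ₗ ℤ →+ k) (toLex (1, 0)) = 1 := by simp [lexFst]
  have h11 : (lexSnd : ℤ ×ₗ ℤ →+ k) (toLex (1, 0)) = 0 := by simp [lexSnd]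
  have h20 : (lexFst : ℤ ×ₗ ℤ →+ k) (toLex (0, 1)) = 0 := by simp [lexFst]
  have h21 : (lexSnd : ℤ ×ₗ ℤ →+ k) (toLex (0, 1)) = 1 := by simp [lexSnd]
  -- `x` and `y` go to the monomials with exponents `(1, 0)` and `(0, 1)`, whose Jacobian is the
  -- monomial with exponent `(1, 1)`.
  obtain ⟨Φ, hx, hy⟩ := exists_algHom_of_jacobian (hahnEuler (lexFst : ℤ ×ₗ ℤ →+ k))
    (hahnEuler lexSnd) (HahnSeries.single (toLex (1, 0)) 1) (HahnSeries.single (toLex (0, 1)) 1)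
    (by
      rw [hs, hs, hs, hs, h10, h11, h20, h21]
      simp)
  refine ⟨Φ, fun a => ?_⟩
  rw [derivation_algHom (hahnEuler lexFst), derivation_algHom (hahnEuler lexSnd), hx, hy, hs, hs,
    hs, hs, h10, h11, h20, h21, HahnSeries.single_eq_zero, mul_zero, add_zero,
    HahnSeries.single_eq_zero, mul_zero, zero_add, euler_zero_apply, euler_one_apply, map_mul,
    map_mul, hx, hy]
  exact ⟨mul_comm _ _, mul_comm _ _⟩

/-- If `{a, b} = c a b` for the bracket with `{x, y} = x y`, then `c` is an integer. -/
theorem exists_int_of_logBracket_eq [CharZero k] {a b : RatField k} {c : k} (ha : a ≠ 0)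
    (hb : b ≠ 0) (h : logBracket a b = c • (a * b)) : ∃ z : ℤ, c = z := by
  obtain ⟨Φ, hΦ⟩ := exists_algHom_hahnSeries (k := k)
  have hab : Φ a * Φ b ≠ 0 := mul_ne_zero ((map_ne_zero Φ).2 ha) ((map_ne_zero Φ).2 hb)
  have h1 := congrArg Φ h
  rw [logBracket, map_sub, map_mul, map_mul, (hΦ a).1, (hΦ a).2, (hΦ b).1, (hΦ b).2, map_smul,
    map_mul] at h1
  have h2 := coeff_hahnEuler_bracket lexFst lexSnd (Φ a) (Φ b)
  rw [h1, HahnSeries.coeff_smul, smul_eq_mul] at h2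
  have h3 : (Φ a * Φ b).coeff ((Φ a).order + (Φ b).order) ≠ 0 := by
    rw [HahnSeries.coeff_mul_order_add_order, ← HahnSeries.leadingCoeff_mul]
    exact HahnSeries.leadingCoeff_ne_zero.2 hab
  -- The integer is the determinant of the two leading exponents.
  refine ⟨(ofLex (Φ a).order).1 * (ofLex (Φ b).order).2 -
    (ofLex (Φ a).order).2 * (ofLex (Φ b).order).1, ?_⟩
  rw [mul_right_cancel₀ h3 h2]
  push_cast
  rfl

/-- No bracket is a nonzero constant when `{x, y} = x y`. -/
theorem logBracket_ne_algebraMap [CharZero k] {a b : RatField k} {c : k} (hc : c ≠ 0) :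
    logBracket a b ≠ algebraMap k _ c := by
  intro h
  obtain ⟨Φ, hΦ⟩ := exists_algHom_hahnSeries (k := k)
  have h1 := congrArg Φ h
  rw [logBracket, map_sub, map_mul, map_mul, (hΦ a).1, (hΦ a).2, (hΦ b).1, (hΦ b).2,
    AlgHom.commutes] at h1
  have h2 := coeff_zero_hahnEuler_bracket lexFst lexSnd (Φ a) (Φ b)
  rw [h1, HahnSeries.algebraMap_apply, HahnSeries.C_apply, HahnSeries.coeff_single_same] at h2
  exact hc (by simpa using h2)

end Hahn

/-! ## Local rings of primes and logarithmic brackets -/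

section Rigidity

variable {k : Type*} [Field k]

open MvPolynomial

local notation "ι" => algebraMap (MvPolynomial (Fin 2) k) (RatField k)

/-- The local ring of `k[x, y]` at a prime element `P`, as a subring of `k(x, y)`. -/
def primeSubring (P : MvPolynomial (Fin 2) k) (hP : Prime P) : Subring (RatField k) where
  carrier := {g | ∃ n d, ¬ P ∣ d ∧ g * ι d = ι n}
  one_mem' := ⟨1, 1, hP.not_dvd_one, by simp⟩
  zero_mem' := ⟨0, 1, hP.not_dvd_one, by simp⟩
  mul_mem' := by
    rintro a b ⟨n, d, hd, h⟩ ⟨m, e, he, h'⟩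
    exact ⟨n * m, d * e, fun hde => (hP.dvd_or_dvd hde).elim hd he, by
      rw [map_mul, map_mul, ← h, ← h']; ring⟩
  add_mem' := by
    rintro a b ⟨n, d, hd, h⟩ ⟨m, e, he, h'⟩
    exact ⟨n * e + m * d, d * e, fun hde => (hP.dvd_or_dvd hde).elim hd he, by
      rw [map_add, map_mul, map_mul, map_mul, ← h, ← h']; ring⟩
  neg_mem' := by
    rintro a ⟨n, d, hd, h⟩
    exact ⟨-n, d, hd, by rw [map_neg, ← h]; ring⟩

theorem algebraMap_ne_zero_of_ne_zero {d : MvPolynomial (Fin 2) k} (hd : d ≠ 0) : ι d ≠ 0 := by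
  rwa [Ne, map_eq_zero_iff _ algebraMap_injective_ratField]

variable {P : MvPolynomial (Fin 2) k} {hP : Prime P}

theorem algebraMap_mem_primeSubring (n : MvPolynomial (Fin 2) k) : ι n ∈ primeSubring P hP :=
  ⟨n, 1, hP.not_dvd_one, by rw [map_one, mul_one]⟩

theorem algebraMap_base_mem_primeSubring (c : k) :
    algebraMap k (RatField k) c ∈ primeSubring P hP := by
  rw [← algebraMap_C_ratField]
  exact algebraMap_mem_primeSubring _

theorem algebraMap_ne_zero_of_not_dvd {d : MvPolynomial (Fin 2) k} (hd : ¬ P ∣ d) : ι d ≠ 0 :=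
  algebraMap_ne_zero_of_ne_zero fun h => hd (h ▸ dvd_zero P)

theorem div_mem_primeSubring (n : MvPolynomial (Fin 2) k) {d : MvPolynomial (Fin 2) k}
    (hd : ¬ P ∣ d) : ι n / ι d ∈ primeSubring P hP :=
  ⟨n, d, hd, div_mul_cancel₀ _ (algebraMap_ne_zero_of_not_dvd hd)⟩

theorem inv_notMem_primeSubring : (ι P)⁻¹ ∉ primeSubring P hP := by
  rintro ⟨n, d, hd, h⟩
  have hP0 : ι P ≠ 0 := algebraMap_ne_zero_of_ne_zero hP.ne_zero
  refine hd ⟨n, algebraMap_injective_ratField ?_⟩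
  rw [map_mul, ← h]
  field_simp

theorem exists_eq_zpow_mul (hP : Prime P) {a : RatField k} (ha : a ≠ 0) :
    ∃ (i : ℤ) (u w : MvPolynomial (Fin 2) k), ¬ P ∣ u ∧ ¬ P ∣ w ∧ a = ι P ^ i * (ι u / ι w) := by
  have hP0 : ι P ≠ 0 := algebraMap_ne_zero_of_ne_zero hP.ne_zero
  obtain ⟨n, d, hd, rfl⟩ := IsFractionRing.div_surjective (A := MvPolynomial (Fin 2) k) a
  have hn : n ≠ 0 := by
    rintro rfl
    simp at ha
  obtain ⟨i, u, hu, rfl⟩ := WfDvdMonoid.max_power_factor hn hP.irreducible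
  obtain ⟨j, w, hw, rfl⟩ := WfDvdMonoid.max_power_factor (nonZeroDivisors.ne_zero hd)
    hP.irreducible
  refine ⟨i - j, u, w, hu, hw, ?_⟩
  rw [zpow_sub₀ hP0, zpow_natCast, zpow_natCast, map_mul, map_mul, map_pow, map_pow]
  ring

/-- The valuation dichotomy: an element with a pole along `P` has its inverse in the maximal ideal.
-/
theorem mem_or_inv_eq_mul_primeSubring (hP : Prime P) (a : RatField k) :
    a ∈ primeSubring P hP ∨ ∃ g ∈ primeSubring P hP, a⁻¹ = ι P * g := by
  by_cases ha : a = 0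
  · exact Or.inl (ha ▸ zero_mem _)
  have hP0 : ι P ≠ 0 := algebraMap_ne_zero_of_ne_zero hP.ne_zero
  obtain ⟨i, u, w, hu, hw, rfl⟩ := exists_eq_zpow_mul hP ha
  obtain ⟨j, rfl | rfl⟩ := i.eq_nat_or_neg
  · left
    rw [zpow_natCast]
    exact mul_mem (pow_mem (algebraMap_mem_primeSubring _) _) (div_mem_primeSubring _ hw)
  · rcases j with _ | j
    · left
      simpa using div_mem_primeSubring (hP := hP) u hw
    · right
      refine ⟨ι P ^ j * (ι w / ι u), mul_mem (pow_mem (algebraMap_mem_primeSubring _) _)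
        (div_mem_primeSubring _ hu), ?_⟩
      rw [mul_inv, zpow_neg, inv_inv, zpow_natCast, inv_div, pow_succ]
      ring

/-- Logarithmic derivatives have at most simple poles, with residue the order of vanishing. -/
theorem exists_euler_eq (hP : Prime P) {a : RatField k} (ha : a ≠ 0) :
    ∃ i : ℤ, ∀ s, ∃ α ∈ primeSubring P hP,
      euler s a = a * (i * (euler s (ι P) / ι P) + α) := by
  have hP0 : ι P ≠ 0 := algebraMap_ne_zero_of_ne_zero hP.ne_zero
  obtain ⟨i, u, w, hu, hw, rfl⟩ := exists_eq_zpow_mul hP ha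
  have hu0 := algebraMap_ne_zero_of_not_dvd hu
  have hw0 := algebraMap_ne_zero_of_not_dvd hw
  refine ⟨i, fun s => ⟨ι (polyEuler s u) / ι u - ι (polyEuler s w) / ι w,
    sub_mem (div_mem_primeSubring _ hu) (div_mem_primeSubring _ hw), ?_⟩⟩
  rw [Derivation.leibniz, Derivation.leibniz_zpow, Derivation.leibniz_div, zpow_sub_one₀ hP0,
    euler_algebraMap s u, euler_algebraMap s w]
  simp only [smul_eq_mul, zsmul_eq_mul]
  field_simp
  ring

/-- The logarithmic derivatives of `a` and `b` have polar parts `i` and `j` times those of `P`, with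
the same `i`, `j` for both Euler operators. Hence the products of polar parts cancel in the
determinant, and a factor `t` clearing the poles of `θ_s P / P` suffices. -/
theorem mul_logBracket_div_mem {a b t : RatField k} (ha : a ≠ 0) (hb : b ≠ 0)
    (ht : t ∈ primeSubring P hP)
    (htP : ∀ s, t * (euler s (ι P) / ι P) ∈ primeSubring P hP) :
    t * (logBracket a b / (a * b)) ∈ primeSubring P hP := by
  obtain ⟨i, hi⟩ := exists_euler_eq hP ha
  obtain ⟨j, hj⟩ := exists_euler_eq hP hb
  obtain ⟨α₀, hα₀, h1⟩ := hi 0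
  obtain ⟨α₁, hα₁, h2⟩ := hi 1
  obtain ⟨β₀, hβ₀, h3⟩ := hj 0
  obtain ⟨β₁, hβ₁, h4⟩ := hj 1
  have : t * (logBracket a b / (a * b)) =
      t * (euler 0 (ι P) / ι P) * (i * β₁ - j * α₁) +
        t * (euler 1 (ι P) / ι P) * (j * α₀ - i * β₀) + t * (α₀ * β₁ - α₁ * β₀) := by
    rw [logBracket, h1, h2, h3, h4]
    field_simp
    ring
  rw [this]
  have hint : ∀ z : ℤ, (z : RatField k) ∈ primeSubring P hP := fun z => intCast_mem _ z
  exact add_mem (add_mem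
    (mul_mem (htP 0) (sub_mem (mul_mem (hint _) hβ₁) (mul_mem (hint _) hα₁)))
    (mul_mem (htP 1) (sub_mem (mul_mem (hint _) hα₀) (mul_mem (hint _) hβ₀))))
    (mul_mem ht (sub_mem (mul_mem hα₀ hβ₁) (mul_mem hα₁ hβ₀)))

theorem algebraMap_mul_logBracket_div_mem {a b : RatField k} (ha : a ≠ 0) (hb : b ≠ 0) :
    ι P * (logBracket a b / (a * b)) ∈ primeSubring P hP := by
  have hP0 : ι P ≠ 0 := algebraMap_ne_zero_of_ne_zero hP.ne_zero
  refine mul_logBracket_div_mem ha hb (algebraMap_mem_primeSubring _) fun s => ?_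
  rw [mul_div_cancel₀ _ hP0, euler_algebraMap]
  exact algebraMap_mem_primeSubring _

/-- Here `P` is a coordinate up to a unit, so it divides its Euler derivatives and even the simple
pole disappears. -/
theorem logBracket_div_mem_of_dvd_X {a b : RatField k} (ha : a ≠ 0) (hb : b ≠ 0) {i : Fin 2}
    (h : P ∣ X i) : logBracket a b / (a * b) ∈ primeSubring P hP := by
  have hP0 : ι P ≠ 0 := algebraMap_ne_zero_of_ne_zero hP.ne_zero
  obtain ⟨v, hv⟩ : Associated (X i) P := (hP.associated_of_dvd (X_prime (R := k)) h).symm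
  have hdvd : ∀ s, P ∣ polyEuler s P := by
    intro s
    refine h.trans ?_
    nth_rw 1 [← hv]
    rw [Derivation.leibniz, smul_eq_mul, smul_eq_mul]
    refine dvd_add (dvd_mul_right _ _) (Dvd.dvd.mul_left ?_ _)
    rw [polyEuler_apply, pderiv_X]
    by_cases his : s = i
    · subst his; simp
    · simp [Ne.symm his]
  have := mul_logBracket_div_mem (hP := hP) (t := 1) ha hb (one_mem _) fun s => by
    obtain ⟨e, he⟩ := hdvd s
    rw [one_mul, euler_algebraMap, he, map_mul, mul_div_cancel_left₀ _ hP0]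
    exact algebraMap_mem_primeSubring _
  rwa [one_mul] at this

/-- A prime factor of the reduced denominator would be a pole. -/
theorem exists_algebraMap_eq_of_forall_mem_primeSubring {f : RatField k}
    (h : ∀ (P : MvPolynomial (Fin 2) k) (hP : Prime P), f ∈ primeSubring P hP) :
    ∃ p, f = ι p := by
  have hred := IsFractionRing.num_den_reduced (MvPolynomial (Fin 2) k) f
  have hu : IsUnit (IsFractionRing.den (MvPolynomial (Fin 2) k) f : MvPolynomial (Fin 2) k) := by
    by_contra hu
    have hd0 := nonZeroDivisors.ne_zero (IsFractionRing.den (MvPolynomial (Fin 2) k) f).2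
    obtain ⟨P, hirr, hPd⟩ := WfDvdMonoid.exists_irreducible_factor hu hd0
    have hP := UniqueFactorizationMonoid.irreducible_iff_prime.1 hirr
    obtain ⟨n, d, hd, hnd⟩ := h P hP
    have h1 := IsFractionRing.mk'_num_den' (MvPolynomial (Fin 2) k) f
    have hd' : ι (IsFractionRing.den (MvPolynomial (Fin 2) k) f : MvPolynomial (Fin 2) k) ≠ 0 :=
      algebraMap_ne_zero_of_ne_zero hd0
    rw [div_eq_iff hd'] at h1
    have h2 : IsFractionRing.num (MvPolynomial (Fin 2) k) f * d =
        n * (IsFractionRing.den (MvPolynomial (Fin 2) k) f : MvPolynomial (Fin 2) k) := by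
      apply algebraMap_injective_ratField
      rw [map_mul, map_mul, ← hnd, h1]
      ring
    have h3 : P ∣ IsFractionRing.num (MvPolynomial (Fin 2) k) f * d := h2 ▸ hPd.mul_left n
    exact hirr.not_isUnit (hred ((hP.dvd_or_dvd h3).resolve_right hd) hPd)
  obtain ⟨p, hp⟩ := IsFractionRing.isInteger_of_isUnit_den hu
  exact ⟨p, hp.symm⟩

/-- Total degrees do not increase when forming logarithmic brackets. -/
theorem exists_logBracket_div_eq {a b : RatField k} (ha : a ≠ 0) (hb : b ≠ 0) :
    ∃ n d : MvPolynomial (Fin 2) k, d ≠ 0 ∧ n.totalDegree ≤ d.totalDegree ∧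
      logBracket a b / (a * b) * ι d = ι n := by
  obtain ⟨p, q, hq, rfl⟩ := IsFractionRing.div_surjective (A := MvPolynomial (Fin 2) k) a
  obtain ⟨r, s, hs, rfl⟩ := IsFractionRing.div_surjective (A := MvPolynomial (Fin 2) k) b
  have hq0 := nonZeroDivisors.ne_zero hq
  have hs0 := nonZeroDivisors.ne_zero hs
  have hp0 : p ≠ 0 := by rintro rfl; simp at ha
  have hr0 : r ≠ 0 := by rintro rfl; simp at hb
  have w : ∀ (i : Fin 2) (p q : MvPolynomial (Fin 2) k),
      (q * polyEuler i p - p * polyEuler i q).totalDegree ≤ p.totalDegree + q.totalDegree := by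
    intro i p q
    refine (totalDegree_sub _ _).trans (max_le ?_ ?_)
    · have := totalDegree_mul q (polyEuler i p)
      have := totalDegree_polyEuler_le i p
      omega
    · have := totalDegree_mul p (polyEuler i q)
      have := totalDegree_polyEuler_le i q
      omega
  -- The logarithmic derivatives of `p / q` and `r / s` have denominators `p q` and `r s`; Euler
  -- operators do not raise degrees, so each numerator is bounded by its denominator.
  refine ⟨(q * polyEuler 0 p - p * polyEuler 0 q) * (s * polyEuler 1 r - r * polyEuler 1 s) -
    (q * polyEuler 1 p - p * polyEuler 1 q) * (s * polyEuler 0 r - r * polyEuler 0 s),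
    p * q * (r * s), mul_ne_zero (mul_ne_zero hp0 hq0) (mul_ne_zero hr0 hs0), ?_, ?_⟩
  · rw [totalDegree_mul_of_isDomain (mul_ne_zero hp0 hq0) (mul_ne_zero hr0 hs0),
      totalDegree_mul_of_isDomain hp0 hq0, totalDegree_mul_of_isDomain hr0 hs0]
    exact (totalDegree_sub _ _).trans (max_le
      ((totalDegree_mul _ _).trans (add_le_add (w 0 p q) (w 1 r s)))
      ((totalDegree_mul _ _).trans (add_le_add (w 1 p q) (w 0 r s))))
  · have := algebraMap_ne_zero_of_ne_zero hp0
    have := algebraMap_ne_zero_of_ne_zero hq0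
    have := algebraMap_ne_zero_of_ne_zero hr0
    have := algebraMap_ne_zero_of_ne_zero hs0
    simp only [logBracket, Derivation.leibniz_div, euler_algebraMap, smul_eq_mul, map_mul, map_sub]
    field_simp

/-- `a` is integral over `k[x, y]`, which is integrally closed. -/
theorem eq_algebraMap_of_pow_eq {a : RatField k} {m : ℕ} (hm : m ≠ 0)
    {p : MvPolynomial (Fin 2) k} (h : a ^ m = ι p) :
    ∃ r, a = ι r ∧ m * r.totalDegree = p.totalDegree := by
  obtain ⟨r, hr⟩ := IsIntegrallyClosed.exists_algebraMap_eq_of_isIntegral_pow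
    (R := MvPolynomial (Fin 2) k) (Nat.pos_of_ne_zero hm) (h ▸ isIntegral_algebraMap)
  refine ⟨r, hr.symm, ?_⟩
  rw [← hr, ← map_pow] at h
  rw [← algebraMap_injective_ratField h]
  by_cases h0 : r = 0
  · simp [h0, hm]
  · clear h hr hm
    induction m with
    | zero => simp
    | succ m ih =>
      rw [pow_succ, totalDegree_mul_of_isDomain (pow_ne_zero m h0) h0, ← ih, Nat.succ_mul]

/-- If `{a, b} = c a ^ (m + 1) b / x ^ n` for the bracket with `{x, y} = x y`, and `m ≥ 2`, then
`a` is a constant times a power of `x`, with exponent `n / m`. -/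
theorem eq_smul_pow_of_logBracket_eq {a b : RatField k} {c : k} {m n : ℕ} (hm : 2 ≤ m)
    (hc : c ≠ 0) (ha : a ≠ 0) (hb : b ≠ 0)
    (h : logBracket a b / (a * b) * varX ^ n = c • a ^ m) :
    ∃ i : ℕ, n = m * i ∧ ∃ e : k, a = e • varX ^ i := by
  have hx := varX_ne_zero (k := k)
  have hc' : algebraMap k (RatField k) c ≠ 0 := by simpa using hc
  rw [Algebra.smul_def] at h
  set f := logBracket a b / (a * b) with hf
  have hloc : ∀ (P : MvPolynomial (Fin 2) k) (hP : Prime P), f ∈ primeSubring P hP := by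
    intro P hP
    by_cases hPX : P ∣ X 0
    · exact logBracket_div_mem_of_dvd_X ha hb hPX
    have hxinv : (varX : RatField k)⁻¹ ∈ primeSubring P hP := by
      have := div_mem_primeSubring (hP := hP) 1 hPX
      rwa [map_one, one_div] at this
    rcases mem_or_inv_eq_mul_primeSubring hP a with haO | ⟨g, hg, hag⟩
    · have : f = algebraMap k _ c * a ^ m * (varX⁻¹) ^ n := by
        rw [← h, inv_pow]
        field_simp
      rw [this]
      exact mul_mem (mul_mem (algebraMap_base_mem_primeSubring c) (pow_mem haO _))
        (pow_mem hxinv _)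
    -- A pole of `a` along `P` would give `f` a pole of order at least `m ≥ 2`, as `x` is a unit
    -- there, but `f` has at most a simple pole. The number `l = m - 2` counts the spare factors of
    -- `P`.
    · exfalso
      have hP0 : ι P ≠ 0 := algebraMap_ne_zero_of_ne_zero hP.ne_zero
      obtain ⟨l, rfl⟩ := Nat.exists_eq_add_of_le hm
      have key : (ι P)⁻¹ = algebraMap k _ c⁻¹ * (ι P ^ l * g ^ (2 + l) * varX ^ n * (ι P * f)) := by
        have h1 : (ι P * g) ^ (2 + l) * a ^ (2 + l) = 1 := by
          rw [← hag, ← mul_pow, inv_mul_cancel₀ ha, one_pow]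
        have h2 : a ^ (2 + l) = algebraMap k _ c⁻¹ * (f * varX ^ n) := by
          rw [h, map_inv₀, inv_mul_cancel_left₀ hc']
        rw [h2] at h1
        rw [inv_eq_iff_eq_inv, ← one_div, eq_div_iff_mul_eq, ← h1]
        · rw [mul_pow]; ring
        · intro h0
          rw [mul_pow] at h1
          refine zero_ne_one (α := RatField k) ?_
          rw [← h1, ← mul_zero (ι P), ← h0]
          ring
      refine inv_notMem_primeSubring (hP := hP) ?_
      rw [key]
      refine mul_mem (algebraMap_base_mem_primeSubring _) (mul_mem (mul_mem (mul_mem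
        (pow_mem (algebraMap_mem_primeSubring _) _) (pow_mem hg _))
        (pow_mem (algebraMap_mem_primeSubring _) _)) (algebraMap_mul_logBracket_div_mem ha hb))
  obtain ⟨p, hp⟩ := exists_algebraMap_eq_of_forall_mem_primeSubring hloc
  have hf0 : f ≠ 0 := fun h0 => by
    rw [h0, zero_mul] at h
    exact mul_ne_zero hc' (pow_ne_zero m ha) h.symm
  have hp0 : p ≠ 0 := fun h0 => hf0 (by rw [hp, h0, map_zero])
  -- A polynomial that is a quotient with numerator of no larger degree than the denominator is
  -- constant.
  have hpd : p.totalDegree = 0 := by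
    obtain ⟨u, d, hd, hud, hfd⟩ := exists_logBracket_div_eq ha hb
    rw [← hf, hp, ← map_mul] at hfd
    rw [← algebraMap_injective_ratField hfd, totalDegree_mul_of_isDomain hp0 hd] at hud
    omega
  have hpow : a ^ m = ι (C c⁻¹ * p * X 0 ^ n) := by
    rw [map_mul, map_mul, map_pow, algebraMap_C_ratField, mul_assoc, ← hp]
    change _ = _ * (f * varX ^ n)
    rw [h, map_inv₀, inv_mul_cancel_left₀ hc']
  have hcp : C c⁻¹ * p ≠ 0 := mul_ne_zero (by simpa using hc) hp0
  have hcpd : (C c⁻¹ * p).totalDegree = 0 := by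
    rw [totalDegree_mul_of_isDomain (by simpa using hc) hp0, hpd, totalDegree_C]
  obtain ⟨r, hr, hdeg⟩ := eq_algebraMap_of_pow_eq (by omega) hpow
  rw [totalDegree_mul_of_isDomain hcp (pow_ne_zero n (X_ne_zero 0)), hcpd, totalDegree_X_pow,
    zero_add] at hdeg
  refine ⟨r.totalDegree, hdeg.symm, ?_⟩
  -- Dividing out the power of `x` leaves an `m`-th root of a constant, which is again a polynomial,
  -- now of degree zero.
  have hpow' : (a / varX ^ r.totalDegree) ^ m = ι (C c⁻¹ * p) := by
    rw [div_pow, ← pow_mul, mul_comm _ m, hdeg, div_eq_iff (pow_ne_zero n hx), hpow, map_mul,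
      map_pow]
    rfl
  obtain ⟨s, hs, hsd⟩ := eq_algebraMap_of_pow_eq (by omega) hpow'
  rw [hcpd, mul_eq_zero, or_iff_right (by omega), totalDegree_eq_zero_iff_eq_C] at hsd
  refine ⟨coeff 0 s, ?_⟩
  rw [Algebra.smul_def, ← algebraMap_C_ratField, ← hsd, ← hs, div_mul_cancel₀ _ (pow_ne_zero _ hx)]

end Rigidity

/-! ## Embeddings between the Poisson fields -/

section PoissonFieldEmbeddings

variable {k : Type*} [Field k]

theorem euler_zero_varX : euler 0 (varX : RatField k) = varX := by
  rw [euler_zero_apply, partialD_zero_varX, mul_one]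

theorem euler_zero_varY : euler 0 (varY : RatField k) = 0 := by
  rw [euler_zero_apply, partialD_zero_varY, mul_zero]

theorem euler_one_varX : euler 1 (varX : RatField k) = 0 := by
  rw [euler_one_apply, partialD_one_varX, mul_zero]

theorem euler_one_varY : euler 1 (varY : RatField k) = varY := by
  rw [euler_one_apply, partialD_one_varY, mul_one]

theorem derivation_zpow {L : Type*} [Field L] [Algebra k L] (D : Derivation k L L) (a : L)
    (z : ℤ) : D (a ^ z) = z * (a ^ (z - 1) * D a) := by
  rw [Derivation.leibniz_zpow, smul_eq_mul, zsmul_eq_mul]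

theorem algHom_smul (φ : RatField k →ₐ[k] RatField k) (c : k) (a : RatField k) :
    φ (c • a) = c • φ a := by
  rw [Algebra.smul_def, Algebra.smul_def, map_mul, AlgHom.commutes]

theorem euler_zero_varX_zpow (z : ℤ) :
    euler 0 ((varX : RatField k) ^ z) = (z : RatField k) * varX ^ z := by
  rw [derivation_zpow, euler_zero_varX, zpow_sub_one₀ varX_ne_zero,
    inv_mul_cancel_right₀ varX_ne_zero]

theorem euler_one_varX_zpow (z : ℤ) : euler 1 ((varX : RatField k) ^ z) = 0 := by
  rw [derivation_zpow, euler_one_varX, mul_zero, mul_zero]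

theorem euler_zero_varY_zpow (z : ℤ) : euler 0 ((varY : RatField k) ^ z) = 0 := by
  rw [derivation_zpow, euler_zero_varY, mul_zero, mul_zero]

theorem euler_one_varY_zpow (z : ℤ) :
    euler 1 ((varY : RatField k) ^ z) = (z : RatField k) * varY ^ z := by
  rw [derivation_zpow, euler_one_varY, zpow_sub_one₀ varY_ne_zero,
    inv_mul_cancel_right₀ varY_ne_zero]

theorem euler_one_eq_zero_iff {a : RatField k} : euler 1 a = 0 ↔ partialD 1 a = 0 := by
  rw [euler_one_apply, mul_eq_zero, or_iff_right varY_ne_zero]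

theorem skewField_bracket (q : k) (a b : RatField k) :
    (skewField q).bracket a b = q • logBracket a b := by
  rw [skewField, flagBracket_eq_logBracket, smul_div_assoc,
    div_self (mul_ne_zero varX_ne_zero varY_ne_zero), mul_smul_comm, mul_one]

theorem monomialField_bracket (q : k) (n : ℕ) (a b : RatField k) :
    (monomialField q n 0).bracket a b = q • (logBracket a b * varX ^ n) := by
  have hx := varX_ne_zero (k := k)
  have hy := varY_ne_zero (k := k)
  rw [monomialField, flagBracket_eq_logBracket, smul_div_assoc, mul_smul_comm, add_zero, zpow_one,
    zpow_add₀ hx, zpow_one, zpow_natCast]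
  congr 1
  field_simp

/-- A criterion for embeddings of `K{f}` in terms of the images of the generators. -/
theorem poissonEmbeds_of_bracket_eq [CharZero k] {f g u v : RatField k}
    (hne : (flagBracket g).bracket u v ≠ 0)
    (h : ∀ φ : RatField k →ₐ[k] RatField k, φ varX = u → φ varY = v →
      (flagBracket g).bracket u v = φ f) :
    PoissonEmbeds (flagBracket f) (flagBracket g) := by
  obtain ⟨φ, hx, hy⟩ := exists_algHom_of_bracket_ne_zero hne
  exact (poissonEmbeds_flagBracket_iff f g).2 ⟨φ, by rw [hx, hy]; exact h φ hx hy⟩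

/-- The case `n = 1` is needed too: it reduces embeddings into the Weyl field to embeddings into
`K_{1,1,0}`. -/
theorem weylField_embeds_monomialField [CharZero k] {n : ℕ} (hn : n ≠ 0) :
    PoissonEmbeds (weylField : PoissonBracket k (RatField k)) (monomialField 1 n 0) := by
  have hx := varX_ne_zero (k := k)
  have hy := varY_ne_zero (k := k)
  have hn' : (n : RatField k) ≠ 0 := by
    have := (map_ne_zero (algebraMap k (RatField k))).2 (Nat.cast_ne_zero (R := k).2 hn)
    rwa [map_natCast] at this
  -- With `y` fixed, the image `u` of `x` must satisfy `θ₀ u = x^(-n) y^(-1)`.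
  have key : (monomialField (1 : k) n 0).bracket
      ((algebraMap k _ (-(n : k)⁻¹)) * (varX ^ (-(n : ℤ)) * varY ^ (-1 : ℤ))) varY = 1 := by
    rw [monomialField_bracket, logBracket, euler_zero_varY, euler_one_varY, ← Algebra.smul_def,
      Derivation.map_smul, Derivation.leibniz, smul_eq_mul, smul_eq_mul, euler_zero_varX_zpow,
      euler_zero_varY_zpow]
    simp only [Algebra.smul_def, zpow_neg, zpow_natCast, map_neg, map_inv₀,
      map_natCast, map_one]
    push_cast
    field_simp
    simp
  exact poissonEmbeds_of_bracket_eq (key.trans_ne one_ne_zero) fun φ _ _ => by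
    rw [map_one]; exact key

theorem skewField_embeds_skewField_iff [CharZero k] {p q : k} (hp : p ≠ 0) (hq : q ≠ 0) :
    PoissonEmbeds (skewField p) (skewField q) ↔ ∃ z : ℤ, p = z * q := by
  have hx := varX_ne_zero (k := k)
  have hy := varY_ne_zero (k := k)
  constructor
  · intro h
    obtain ⟨φ, hφ⟩ := (poissonEmbeds_flagBracket_iff _ _).1 h
    change (skewField q).bracket _ _ = _ at hφ
    rw [skewField_bracket, algHom_smul, map_mul] at hφ
    obtain ⟨z, hz⟩ := exists_int_of_logBracket_eq (c := q⁻¹ * p) ((map_ne_zero φ).2 hx)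
      ((map_ne_zero φ).2 hy) (by rw [mul_smul, ← hφ, inv_smul_smul₀ hq])
    exact ⟨z, by rw [← hz]; field_simp⟩
  · rintro ⟨z, rfl⟩
    -- The map `x ↦ x^z`, `y ↦ y` scales the logarithmic bracket by `z`.
    have key : (skewField q).bracket (varX ^ z) varY =
        ((z : k) * q) • ((varX : RatField k) ^ z * varY) := by
      rw [skewField_bracket, logBracket, euler_zero_varX_zpow, euler_zero_varY, euler_one_varY,
        mul_zero, sub_zero, mul_comm (z : k), mul_smul, Algebra.smul_def (z : k), map_intCast,
        mul_assoc]
    refine poissonEmbeds_of_bracket_eq (u := varX ^ z) (v := varY) ?_ fun φ hφx hφy => ?_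
    · exact key.trans_ne (smul_ne_zero hp (mul_ne_zero (zpow_ne_zero z hx) hy))
    · rw [algHom_smul, map_mul, hφx, hφy]
      exact key

theorem not_weylField_embeds_skewField [CharZero k] {q : k} (hq : q ≠ 0) :
    ¬ PoissonEmbeds weylField (skewField q) := by
  intro h
  obtain ⟨φ, hφ⟩ := (poissonEmbeds_flagBracket_iff _ _).1 h
  change (skewField q).bracket _ _ = _ at hφ
  rw [skewField_bracket, map_one] at hφ
  refine logBracket_ne_algebraMap (a := φ varX) (b := φ varY) (inv_ne_zero hq) ?_
  rw [Algebra.algebraMap_eq_smul_one, ← hφ, inv_smul_smul₀ hq]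

/-- The logarithmic bracket of the images, divided by their product, would be `q x^(-n)`, which has
a forbidden pole along `x`. -/
theorem not_skewField_embeds_monomialField {q : k} (hq : q ≠ 0) {n : ℕ} (hn : n ≠ 0) :
    ¬ PoissonEmbeds (skewField q) (monomialField 1 n 0) := by
  intro h
  have hx := varX_ne_zero (k := k)
  obtain ⟨φ, hφ⟩ := (poissonEmbeds_flagBracket_iff _ _).1 h
  change (monomialField 1 n 0).bracket _ _ = _ at hφ
  have ha := (map_ne_zero φ).2 hx
  have hb := (map_ne_zero φ).2 (varY_ne_zero (k := k))
  rw [monomialField_bracket, algHom_smul, one_smul, map_mul, Algebra.smul_def] at hφ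
  have hP : Prime (MvPolynomial.X 0 : MvPolynomial (Fin 2) k) := MvPolynomial.X_prime
  refine inv_notMem_primeSubring (hP := hP) ?_
  change (varX : RatField k)⁻¹ ∈ _
  obtain ⟨l, rfl⟩ := Nat.exists_eq_succ_of_ne_zero hn
  have hq' : algebraMap k (RatField k) q ≠ 0 := by simpa using hq
  have key : (varX : RatField k)⁻¹ = algebraMap k _ q⁻¹ * varX ^ l *
      (logBracket (φ varX) (φ varY) / (φ varX * φ varY)) := by
    rw [map_inv₀]
    rw [mul_div_assoc', eq_div_iff (mul_ne_zero ha hb), eq_comm]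
    apply mul_left_cancel₀ (mul_ne_zero hq' hx)
    field_simp
    rw [mul_assoc (algebraMap k (RatField k) q), ← hφ, pow_succ]
    ring
  rw [key]
  exact mul_mem (mul_mem (algebraMap_base_mem_primeSubring _)
    (pow_mem (algebraMap_mem_primeSubring _) _)) (logBracket_div_mem_of_dvd_X ha hb dvd_rfl)

/-- The images of the generators under a Poisson homomorphism from `K_{r,m,0}` to `K_{q,n,0}`. -/
theorem algHom_apply_of_monomialField_bracket [CharZero k] {q r : k} (hq : q ≠ 0) (hr : r ≠ 0)
    {m n : ℕ} (hm : 2 ≤ m) (hn : n ≠ 0) {φ : RatField k →ₐ[k] RatField k}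
    (h : IsPoissonHom (monomialField r m 0) (monomialField q n 0) φ) :
    ∃ i : ℕ, n = m * i ∧ ∃ (e : k) (z : ℤ), e ≠ 0 ∧ z ≠ 0 ∧ r * e ^ m = q * i * z ∧
      φ varX = e • varX ^ i ∧ euler 1 (φ varY) = z * φ varY := by
  have hx := varX_ne_zero (k := k)
  have hy := varY_ne_zero (k := k)
  have ha := (map_ne_zero φ).2 hx
  have hb := (map_ne_zero φ).2 hy
  have hφ : q • (logBracket (φ varX) (φ varY) * varX ^ n) =
      r • (φ varX ^ (1 + m) * φ varY) := by
    rw [← monomialField_bracket]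
    refine ((isPoissonHom_flagBracket_iff _ _ _).1 h).trans ?_
    rw [algHom_smul, map_mul, map_zpow₀, map_zpow₀, add_zero, zpow_one]
    norm_cast
  obtain ⟨i, hi, e, he⟩ := eq_smul_pow_of_logBracket_eq (a := φ varX) (b := φ varY)
    (c := q⁻¹ * r) (n := n) hm (mul_ne_zero (inv_ne_zero hq) hr) ha hb (by
      rw [mul_smul, eq_inv_smul_iff₀ hq, div_mul_eq_mul_div, ← smul_div_assoc, hφ]
      rw [smul_div_assoc, pow_add, pow_one]
      congr 1
      field_simp)
  have hi0 : i ≠ 0 := by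
    rintro rfl
    omega
  have he0 : e ≠ 0 := by
    rintro rfl
    rw [zero_smul] at he
    exact ha he
  have hi' : (i : k) ≠ 0 := Nat.cast_ne_zero.2 hi0
  -- Since `φ x` is a monomial in `x` alone, one term of the bracket drops out and the Poisson
  -- condition becomes an eigenvalue equation.
  have hθ : euler 1 (φ varY) = (r * e ^ m / (q * i)) • φ varY := by
    rw [he, logBracket, Derivation.map_smul, Derivation.map_smul, ← zpow_natCast varX i,
      euler_zero_varX_zpow, euler_one_varX_zpow, zpow_natCast, smul_zero, zero_mul, sub_zero] at hφ
    simp only [Algebra.smul_def, Int.cast_natCast] at hφ ⊢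
    have hq' : algebraMap k (RatField k) q ≠ 0 := by simpa using hq
    have he' : algebraMap k (RatField k) e ≠ 0 := by simpa using he0
    have hi'' : (i : RatField k) ≠ 0 := by
      rw [← map_natCast (algebraMap k (RatField k))]
      simpa using hi0
    rw [map_div₀, map_mul, map_mul, map_pow, map_natCast, div_mul_eq_mul_div,
      eq_div_iff (mul_ne_zero hq' hi'')]
    have hne : algebraMap k (RatField k) e * varX ^ i * varX ^ n ≠ 0 :=
      mul_ne_zero (mul_ne_zero he' (pow_ne_zero _ hx)) (pow_ne_zero _ hx)
    apply mul_right_cancel₀ hne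
    rw [mul_pow, pow_add, pow_one, ← pow_mul, mul_comm i, add_mul, one_mul, ← hi, pow_add] at hφ
    linear_combination hφ
  -- Pairing with `x` turns `θ₁` into a logarithmic bracket, so the eigenvalue is an integer.
  obtain ⟨z, hz⟩ := exists_int_of_logBracket_eq (a := varX) (b := φ varY)
    (c := r * e ^ m / (q * i)) hx hb (by
      rw [logBracket, euler_zero_varX, euler_one_varX, hθ, zero_mul, sub_zero, mul_smul_comm])
  have hz' : r * e ^ m = q * i * z := by
    rw [← hz]
    field_simp
  refine ⟨i, hi, e, z, he0, ?_, hz', he, ?_⟩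
  · rintro rfl
    rw [Int.cast_zero, mul_zero] at hz'
    exact mul_ne_zero hr (pow_ne_zero m he0) hz'
  · rw [hθ, hz, Algebra.smul_def, map_intCast]

theorem monomialField_embeds_monomialField_iff [CharZero k] {q r : k} (hq : q ≠ 0) (hr : r ≠ 0)
    {m n : ℕ} (hm : 2 ≤ m) (hn : n ≠ 0) :
    PoissonEmbeds (monomialField r m 0) (monomialField q n 0) ↔
      m ∣ n ∧ ∃ z : ℤ, z ≠ 0 ∧ ∃ β : k, β ≠ 0 ∧ β ^ m = n * q * z / (m * r) := by
  have hx := varX_ne_zero (k := k)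
  have hy := varY_ne_zero (k := k)
  have hm' : (m : k) ≠ 0 := Nat.cast_ne_zero.2 (by omega)
  constructor
  · rintro ⟨φ, -, hφ⟩
    obtain ⟨i, hi, e, z, he, hz, hrel, -, -⟩ :=
      algHom_apply_of_monomialField_bracket hq hr hm hn hφ
    refine ⟨⟨i, hi⟩, z, hz, e, he, ?_⟩
    rw [eq_div_iff (mul_ne_zero hm' hr), hi, Nat.cast_mul]
    linear_combination m * hrel
  · rintro ⟨⟨i, rfl⟩, z, hz, β, hβ, hrel⟩
    have hrel' : r * β ^ m = q * i * z := by
      rw [eq_div_iff (mul_ne_zero hm' hr), Nat.cast_mul] at hrel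
      apply mul_left_cancel₀ hm'
      linear_combination hrel
    -- The embedding is `x ↦ β x^i`, `y ↦ y^z`.
    have key : (monomialField q (m * i : ℕ) 0).bracket (β • varX ^ i) (varY ^ z) =
        r • ((β • (varX : RatField k) ^ i) ^ (1 + (m : ℤ)) * (varY ^ z) ^ (1 + (0 : ℤ))) := by
      have hrel'' := congrArg (algebraMap k (RatField k)) hrel'
      simp only [map_mul, map_pow, map_natCast, map_intCast] at hrel''
      rw [monomialField_bracket, logBracket, Derivation.map_smul, Derivation.map_smul,
        ← zpow_natCast varX i, euler_zero_varX_zpow, euler_one_varX_zpow, zpow_natCast,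
        smul_zero, zero_mul, sub_zero, euler_one_varY_zpow, add_zero, zpow_one,
        zpow_one_add₀ (smul_ne_zero hβ (pow_ne_zero _ hx)), zpow_natCast]
      simp only [Algebra.smul_def, Int.cast_natCast]
      rw [mul_pow, ← pow_mul, mul_comm i m]
      linear_combination -(algebraMap k _ β * varX ^ i * varX ^ (m * i) * varY ^ z) * hrel''
    refine poissonEmbeds_of_bracket_eq (u := β • varX ^ i) (v := varY ^ z) ?_ fun φ hφx hφy => ?_
    · exact key.trans_ne (smul_ne_zero hr (mul_ne_zero (zpow_ne_zero _ (smul_ne_zero hβ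
        (pow_ne_zero _ hx))) (zpow_ne_zero _ (zpow_ne_zero _ hy))))
    · rw [algHom_smul φ, map_mul φ, map_zpow₀ φ, map_zpow₀ φ, hφx, hφy]
      exact key

/-- Continuing into `K_{1,1,0}` would force `n ∣ 1`. -/
theorem not_monomialField_embeds_weylField [CharZero k] {n : ℕ} (hn : 2 ≤ n) :
    ¬ PoissonEmbeds (monomialField (1 : k) n 0) weylField := by
  intro h
  have := ((monomialField_embeds_monomialField_iff one_ne_zero one_ne_zero hn one_ne_zero).1
    (h.trans (weylField_embeds_monomialField one_ne_zero))).1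
  exact absurd (Nat.le_of_dvd one_pos this) (by omega)

theorem monomialField_one_embeds_iff [CharZero k] {m n : ℕ} (hm : 2 ≤ m) (hn : n ≠ 0) :
    PoissonEmbeds (monomialField (1 : k) m 0) (monomialField (1 : k) n 0) ↔ m ∣ n := by
  rw [monomialField_embeds_monomialField_iff one_ne_zero one_ne_zero hm hn]
  refine ⟨And.left, fun h => ⟨h, ?_⟩⟩
  obtain ⟨i, rfl⟩ := h
  have hm' : (m : k) ≠ 0 := Nat.cast_ne_zero.2 (by omega)
  have hi : i ≠ 0 := right_ne_zero_of_mul hn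
  -- For `n = m i` and `q = r = 1` the condition reads `β^m = i z`, solved by `β = i`, `z =
  -- i^(m-1)`.
  refine ⟨(i : ℤ) ^ (m - 1), pow_ne_zero _ (by exact_mod_cast hi), i, Nat.cast_ne_zero.2 hi, ?_⟩
  obtain ⟨l, rfl⟩ := Nat.exists_eq_succ_of_ne_zero (show m ≠ 0 by omega)
  rw [mul_one, mul_one, eq_div_iff hm']
  rw [Nat.succ_sub_one, pow_succ]
  push_cast
  ring

theorem isPoissonHom_monomialField_iff [CharZero k] {q : k} (hq : q ≠ 0) {n : ℕ} (hn : 2 ≤ n)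
    (φ : RatField k →ₐ[k] RatField k) :
    IsPoissonHom (monomialField q n 0) (monomialField q n 0) φ ↔
      ∃ (c : k) (z : ℤ) (h : RatField k), c ≠ 0 ∧ z ≠ 0 ∧ c ^ n = z ∧
        h ∈ IntermediateField.adjoin k {(varX : RatField k)} ∧ h ≠ 0 ∧
        φ varX = c • varX ∧ φ varY = h * varY ^ z := by
  have hx := varX_ne_zero (k := k)
  have hy := varY_ne_zero (k := k)
  constructor
  · intro hφ
    obtain ⟨i, hi, c, z, hc, hz, hrel, hφx, hφy⟩ :=
      algHom_apply_of_monomialField_bracket hq hq hn (by omega) hφ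
    obtain rfl : i = 1 := by
      have h1 : n * i = n * 1 := by omega
      exact Nat.eq_of_mul_eq_mul_left (by omega) h1
    rw [Nat.cast_one, mul_one] at hrel
    rw [pow_one] at hφx
    refine ⟨c, z, φ varY * varY ^ (-z), hc, hz, mul_left_cancel₀ hq hrel, ?_,
      mul_ne_zero ((map_ne_zero φ).2 hy) (zpow_ne_zero _ hy), hφx, ?_⟩
    -- The factors of `φ y * y^(-z)` have `θ₁`-eigenvalues `z` and `-z`, so the product is killed.
    · apply mem_adjoin_varX_of_partialD_eq_zero
      rw [← euler_one_eq_zero_iff, Derivation.leibniz, hφy, euler_one_varY_zpow]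
      simp only [smul_eq_mul]
      push_cast
      ring
    · rw [zpow_neg, inv_mul_cancel_right₀ (zpow_ne_zero _ hy)]
  · rintro ⟨c, z, h, hc, hz, hcz, hmem, hh, hφx, hφy⟩
    refine (isPoissonHom_flagBracket_iff _ _ _).2 ?_
    change (monomialField q n 0).bracket _ _ = _
    have hh1 : euler 1 h = 0 := euler_one_eq_zero_iff.2 (partialD_eq_zero_of_mem_adjoin_varX hmem)
    have hcz' := congrArg (algebraMap k (RatField k)) hcz
    rw [map_pow, map_intCast] at hcz'
    rw [monomialField_bracket, algHom_smul, map_mul, map_zpow₀, map_zpow₀, hφx, hφy, logBracket,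
      Derivation.map_smul, Derivation.map_smul, euler_zero_varX, euler_one_varX, smul_zero,
      zero_mul, sub_zero, Derivation.leibniz, hh1, euler_one_varY_zpow, smul_zero, smul_eq_mul,
      add_zero, add_zero, zpow_one, zpow_one_add₀ (smul_ne_zero hc hx), zpow_natCast]
    simp only [Algebra.smul_def, mul_pow, ← hcz']
    ring

theorem fieldRange_of_apply {φ : RatField k →ₐ[k] RatField k} {c : k} {z : ℤ} {h : RatField k}
    (hc : c ≠ 0) (hmem : h ∈ IntermediateField.adjoin k {(varX : RatField k)}) (hh : h ≠ 0)
    (hφx : φ varX = c • varX) (hφy : φ varY = h * varY ^ z) :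
    φ.fieldRange = IntermediateField.adjoin k {(varX : RatField k), varY ^ z} := by
  rw [fieldRange_eq_adjoin, hφx, hφy]
  apply le_antisymm
  · rw [IntermediateField.adjoin_le_iff, Set.insert_subset_iff, Set.singleton_subset_iff]
    have h1 : (varX : RatField k) ∈ IntermediateField.adjoin k {(varX : RatField k), varY ^ z} :=
      IntermediateField.subset_adjoin _ _ (Set.mem_insert _ _)
    have h2 : (varY : RatField k) ^ z ∈
        IntermediateField.adjoin k {(varX : RatField k), varY ^ z} :=
      IntermediateField.subset_adjoin _ _ (Set.mem_insert_of_mem _ (Set.mem_singleton _))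
    exact ⟨IntermediateField.smul_mem _ h1, mul_mem
      ((IntermediateField.adjoin_simple_le_iff.2 h1) hmem) h2⟩
  · rw [IntermediateField.adjoin_le_iff, Set.insert_subset_iff, Set.singleton_subset_iff]
    have h1 : c • (varX : RatField k) ∈
        IntermediateField.adjoin k {c • (varX : RatField k), h * varY ^ z} :=
      IntermediateField.subset_adjoin _ _ (Set.mem_insert _ _)
    have h2 : h * (varY : RatField k) ^ z ∈
        IntermediateField.adjoin k {c • (varX : RatField k), h * varY ^ z} :=
      IntermediateField.subset_adjoin _ _ (Set.mem_insert_of_mem _ (Set.mem_singleton _))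
    have h3 : (varX : RatField k) ∈
        IntermediateField.adjoin k {c • (varX : RatField k), h * varY ^ z} := by
      have := IntermediateField.smul_mem _ h1 (x := c⁻¹)
      rwa [inv_smul_smul₀ hc] at this
    refine ⟨h3, ?_⟩
    have h4 := mul_mem (inv_mem ((IntermediateField.adjoin_simple_le_iff.2 h3) hmem)) h2
    rwa [inv_mul_cancel_left₀ hh] at h4

theorem not_hasDixmierProperty_monomialField [CharZero k] {q : k} (hq : q ≠ 0) {n : ℕ}
    (hn : 2 ≤ n) : ¬ HasDixmierProperty (monomialField q n 0) := by
  have hx := varX_ne_zero (k := k)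
  have hy := varY_ne_zero (k := k)
  intro H
  have h2 : (2 : k) ≠ 0 := two_ne_zero
  have hz : (2 : ℤ) ^ n ≠ 0 := pow_ne_zero _ two_ne_zero
  -- The endomorphism with `c = 2`, `z = 2^n`, `h = 1`; its image will be shown to miss `y`.
  obtain ⟨φ, hφx, hφy⟩ := exists_algHom_of_jacobian (euler 0) (euler 1)
    ((2 : k) • (varX : RatField k)) (varY ^ ((2 : ℤ) ^ n)) (by
      rw [Derivation.map_smul, Derivation.map_smul, euler_zero_varX, euler_one_varX, smul_zero,
        zero_mul, sub_zero, euler_one_varY_zpow]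
      refine mul_ne_zero (smul_ne_zero h2 hx) (mul_ne_zero ?_ (zpow_ne_zero _ hy))
      rw [← map_intCast (algebraMap k (RatField k))]
      simp)
  have hφ : IsPoissonHom (monomialField q n 0) (monomialField q n 0) φ :=
    (isPoissonHom_monomialField_iff hq hn φ).2 ⟨2, 2 ^ n, 1, h2, hz, by push_cast; rfl,
      one_mem _, one_ne_zero, hφx, by rw [hφy, one_mul]⟩
  obtain ⟨g, hg⟩ := (H φ hφ).surjective varY
  have hg0 : g ≠ 0 := by
    rintro rfl
    exact hy (by rw [← hg, map_zero])
  have hchain := derivation_algHom (euler 1) φ g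
  rw [hg, hφx, hφy, Derivation.map_smul, euler_one_varX, euler_one_varY, euler_one_varY_zpow,
    smul_zero, mul_zero, zero_add, ← hφy] at hchain
  -- A preimage `g` of `y` would be a `θ₁`-eigenvector with the non-integral eigenvalue `2^(-n)`.
  have hg1 : g = (2 : RatField k) ^ n * euler 1 g := by
    refine φ.injective (?_ : φ g = φ _)
    rw [hg, euler_one_apply, map_mul, map_mul, map_pow, map_ofNat]
    refine hchain.trans ?_
    push_cast
    ring
  have h2n : ((2 : k) ^ n) ≠ 0 := pow_ne_zero _ h2
  obtain ⟨z, hz⟩ := exists_int_of_logBracket_eq (a := varX) (b := g) (c := ((2 : k) ^ n)⁻¹) hx hg0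
    (by
      rw [logBracket, euler_zero_varX, euler_one_varX, zero_mul, sub_zero, eq_inv_smul_iff₀ h2n,
        Algebra.smul_def, map_pow, map_ofNat]
      nth_rw 2 [hg1]
      ring)
  have hone : (2 : ℤ) ^ n * z = 1 := by
    have : ((2 : k) ^ n) * z = 1 := by rw [← hz, mul_inv_cancel₀ h2n]
    exact_mod_cast this
  have hdvd : (2 : ℤ) ∣ 1 := hone ▸ (dvd_pow_self 2 (by omega)).mul_right z
  omega

end PoissonFieldEmbeddings

theorem proposition4p10 {k : Type*} [Field k] [CharZero k] :
    -- the Weyl Poisson field embeds in every `K_{1,n,0}`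
    (∀ n : ℕ, 2 ≤ n → PoissonEmbeds (weylField : PoissonBracket k (RatField k))
      (monomialField 1 n 0)) ∧
    -- embeddings among the `K_q`
    (∀ p q : k, p ≠ 0 → q ≠ 0 →
      (PoissonEmbeds (skewField p) (skewField q) ↔ ∃ z : ℤ, p = z * q)) ∧
    -- embeddings among the `K_{1,n,0}`
    (∀ m n : ℕ, 2 ≤ m → 2 ≤ n →
      (PoissonEmbeds (monomialField (1 : k) m 0) (monomialField (1 : k) n 0) ↔ m ∣ n)) ∧
    -- neither the Weyl Poisson field nor any `K_{1,n,0}` embeds in some `K_q`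
    (∀ q : k, q ≠ 0 →
      ¬ PoissonEmbeds weylField (skewField q) ∧
      ∀ n : ℕ, 2 ≤ n → ¬ PoissonEmbeds (monomialField 1 n 0) (skewField q)) ∧
    -- no `K_{1,n,0}` embeds in the Weyl Poisson field
    (∀ n : ℕ, 2 ≤ n → ¬ PoissonEmbeds (monomialField (1 : k) n 0) weylField) ∧
    -- no `K_q` embeds in the Weyl Poisson field or in some `K_{1,n,0}`
    (∀ q : k, q ≠ 0 →
      ¬ PoissonEmbeds (skewField q) weylField ∧
      ∀ n : ℕ, 2 ≤ n → ¬ PoissonEmbeds (skewField q) (monomialField 1 n 0)) ∧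
    -- the criterion for embeddings of `K_{r,m,0}` in `K_{q,n,0}`
    (∀ q r : k, q ≠ 0 → r ≠ 0 → ∀ m n : ℕ, 2 ≤ m → 2 ≤ n →
      (PoissonEmbeds (monomialField r m 0) (monomialField q n 0) ↔
        m ∣ n ∧ ∃ z : ℤ, z ≠ 0 ∧ ∃ β : k, β ≠ 0 ∧ β ^ m = n * q * z / (m * r))) ∧
    -- the endomorphisms of `K_{q,n,0}`
    (∀ q : k, q ≠ 0 → ∀ n : ℕ, 2 ≤ n →
      (∀ φ : RatField k →ₐ[k] RatField k,
        (IsPoissonHom (monomialField q n 0) (monomialField q n 0) φ ↔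
          ∃ (c : k) (z : ℤ) (h : RatField k), c ≠ 0 ∧ z ≠ 0 ∧ c ^ n = z ∧
            h ∈ IntermediateField.adjoin k {(varX : RatField k)} ∧ h ≠ 0 ∧
            φ varX = c • varX ∧ φ varY = h * varY ^ z)) ∧
      (∀ φ : RatField k →ₐ[k] RatField k,
        IsPoissonHom (monomialField q n 0) (monomialField q n 0) φ →
          ∃ z : ℤ, z ≠ 0 ∧
            φ.fieldRange = IntermediateField.adjoin k {(varX : RatField k), varY ^ z}) ∧
      ¬ HasDixmierProperty (monomialField q n 0)) := by
  refine ⟨fun n hn => weylField_embeds_monomialField (by omega),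
    fun p q hp hq => skewField_embeds_skewField_iff hp hq,
    fun m n hm hn => monomialField_one_embeds_iff hm (by omega),
    -- Since the Weyl field embeds in `K_{1,n,0}`, excluding it from `K_q` excludes `K_{1,n,0}` as
    -- well.
    fun q hq => ⟨not_weylField_embeds_skewField hq, fun n hn h =>
      not_weylField_embeds_skewField hq ((weylField_embeds_monomialField (by omega)).trans h)⟩,
    fun n hn => not_monomialField_embeds_weylField hn,
    fun q hq => ⟨fun h => not_skewField_embeds_monomialField hq one_ne_zero
      (h.trans (weylField_embeds_monomialField one_ne_zero)),
      fun n hn => not_skewField_embeds_monomialField hq (by omega)⟩,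
    fun q r hq hr m n hm hn => monomialField_embeds_monomialField_iff hq hr hm (by omega),
    fun q hq n hn => ⟨isPoissonHom_monomialField_iff hq hn, fun φ hφ => ?_,
      not_hasDixmierProperty_monomialField hq hn⟩⟩
  obtain ⟨c, z, h, hc, hz, -, hmem, hh, hφx, hφy⟩ := (isPoissonHom_monomialField_iff hq hn φ).1 hφ
  exact ⟨z, hz, fieldRange_of_apply hc hmem hh hφx hφy⟩
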